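/- Fix $P,\beta,\gamma>0$ and $\bar B\in\mathbb R$. Consider a transmitter (Alice) with $N_A\ge 2$ antennas, a receiver (Bob) and an eavesdropper (Eve) with one antenna each ($N_B=N_E=1$). The channels $\mathbf H,\mathbf G\in\mathbb C^{1\times N_A}$ have i.i.d. $\mathcal N_{\mathbb C}(0,1)$ entries. A random codebook consists of $2^B$ independent isotropically distributed unit vectors $\tilde{\mathbf V}_1,\dots,\tilde{\mathbf V}_{2^B}\in\mathbb C^{N_A}$; $\mathbf H$, $\mathbf G$ and the codebook are independent. Let $\mathbf V=[\tilde{\mathbf V},\mathbf Z]$ be a unitary matrix with first column $\tilde{\mathbf V}$ and $\mathbf H\mathbf Z=\mathbf 0$. Bob selects an index $j$ that minimizes $d^2(\tilde{\mathbf V}_i,\tilde{\mathbf V})$ over $i$, where $d(\tilde{\mathbf V}_i,\tilde{\mathbf V})=1-|\tilde{\mathbf V}_i^H\tilde{\mathbf V}|^2$, and $\hat{\mathbf V}=[\tilde{\mathbf V}_j,\hat{\mathbf Z}]$ is the unitary matrix obtained by the Gram–Schmidt algorithm from $[\tilde{\mathbf V}_j,\mathbf e_1,\dots,\mathbf e_{N_A-1}]$.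 With a precoder $\mathbf U\in\{\mathbf V,\hat{\mathbf V}\}$ Alice sends $\mathbf x=\mathbf U\begin{bmatrix}u\\ \mathbf v\end{bmatrix}$, where $u\sim\mathcal N_{\mathbb C}(0,\sigma_u^2)$ carries the information and the artificial noise $\mathbf v\in\mathbb C^{N_A-1}$ has i.i.d. $\mathcal N_{\mathbb C}(0,\sigma_v^2)$ entries, with $\sigma_v^2=\beta\sigma_u^2$ and total power $P=\sigma_u^2+\sigma_v^2(N_A-1)$. Bob receives $z=\mathbf H\mathbf x+n_B$ and Eve receives $y=\mathbf G\mathbf x+n_E$, with $n_B\sim\mathcal N_{\mathbb C}(0,1)$ and $n_E\sim\mathcal N_{\mathbb C}(0,\gamma)$; $u,\mathbf v,n_B,n_E$ are independent of each other and of the channels and the codebook. For given channels and codebook, the instantaneous secrecy rate is $I(u;z)-I(u;y)$ (in nats); it is denoted $R_S$ when $\mathbf U=\mathbf V$ (perfect channel knowledge) and $R_{S,Q}$ when $\mathbf U=\hat{\mathbf V}$ (quantized channel knowledge). The ergodic secrecy-rate loss is $\mathrm E(\Delta R_S)=\mathrm E(R_S)-\mathrm E(R_{S,Q})$, the expectation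 being over the channels and the codebook. Then all the mutual informations above are finite, $R_S$ and $R_{S,Q}$ are integrable, and as $N_A,B\to\infty$ with $B/N_A\to\bar B$, $$\mathrm E(\Delta R_S)\;\longrightarrow\;\log\Bigl(1+\frac P\beta\Bigr)+\log\bigl(1+2^{-\bar B}P\bigr)-\log\Bigl(1+P+\frac{1-\beta}{\beta}\bigl(1-2^{-\bar B}\bigr)P\Bigr),$$ where $\log$ is the natural logarithm. -/

import Mathlib

open MeasureTheory ProbabilityTheory Filter Topology
open scoped ENNReal

noncomputable section

/-- The circularly symmetric complex Gaussian law `𝒩_ℂ(0, v)`: independent real and imaginary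
parts, each `𝒩(0, v / 2)`. -/
def complexGaussian (v : ℝ) : Measure ℂ :=
  ((gaussianReal 0 (v / 2).toNNReal).prod (gaussianReal 0 (v / 2).toNNReal)).map
    Complex.measurableEquivRealProd.symm

/-- The mutual information (in nats) of a pair with joint law `ρ`: the Kullback-Leibler divergence
of `ρ` from the product of its marginals. -/
def mutualInfo {X Y : Type*} [MeasurableSpace X] [MeasurableSpace Y] (ρ : Measure (X × Y)) : ℝ≥0∞ :=
  InformationTheory.klDiv ρ (ρ.fst.prod ρ.snd)

/-- `ℂ ^ N` with its Hermitian norm; its elements are column vectors. -/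
abbrev CVec (N : ℕ) : Type := EuclideanSpace ℂ (Fin N)

/-- A unitary `N × N` precoding matrix, given by its columns. -/
abbrev Precoder (N : ℕ) : Type := OrthonormalBasis (Fin N) ℂ (CVec N)

/-- The product `h x` of a row vector and a column vector (no conjugation). -/
def rowMul {N : ℕ} (h : Fin N → ℂ) (x : CVec N) : ℂ := ∑ i, h i * x i

/-- The transmitted vector `x = V [u; v]`: the first column of `V` carries the information symbol
`u`, the other `n` columns carry the artificial noise `v`. The transmitter has `n + 1` antennas. -/
def transmit {n : ℕ} (V : Precoder (n + 1)) (u : ℂ) (v : Fin n → ℂ) : CVec (n + 1) :=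
  u • V 0 + ∑ i : Fin n, v i • V i.succ

/-- The joint law of the information symbol `u ∼ 𝒩_ℂ(0, su)` and the signal `h x + w` received
through the fixed channel `h`, where `x = V [u; v]`, the entries of `v` are i.i.d. `𝒩_ℂ(0, sv)`,
the receiver noise is `w ∼ 𝒩_ℂ(0, s)`, and `u`, `v`, `w` are independent. -/
def channelLaw {n : ℕ} (su sv s : ℝ) (h : Fin (n + 1) → ℂ) (V : Precoder (n + 1)) :
    Measure (ℂ × ℂ) :=
  ((complexGaussian su).prod
    ((Measure.pi fun _ : Fin n => complexGaussian sv).prod (complexGaussian s))).map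
    fun p => (p.1, rowMul h (transmit V p.1 p.2.1) + p.2.2)

/-- The secrecy rate `I(u; z) - I(u; y)` of the artificial noise scheme with Gaussian inputs and
precoder `V`, for given channels `h` (to Bob, noise variance `1`) and `g` (to Eve, noise variance
`sE`). -/
def secrecyRate {n : ℕ} (su sv sE : ℝ) (h g : Fin (n + 1) → ℂ) (V : Precoder (n + 1)) : ℝ :=
  (mutualInfo (channelLaw su sv 1 h V)).toReal - (mutualInfo (channelLaw su sv sE g V)).toReal

/-- The distance `d(a, b) = 1 - Tr(bᴴ a aᴴ b)` of two unit vectors. -/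
def chordalDist {N : ℕ} (a b : CVec N) : ℝ := 1 - ‖inner ℂ a b‖ ^ 2

/-- The precoder obtained by the Gram-Schmidt algorithm from `[w, e₁, …, eₙ]`, where the `eᵢ` are
the first `n` standard basis vectors of `ℂ ^ (n + 1)`; for a unit vector `w` its first column
is `w`. -/
def gramSchmidtPrecoder {n : ℕ} (w : CVec (n + 1)) : Precoder (n + 1) :=
  InnerProductSpace.gramSchmidtOrthonormalBasis (𝕜 := ℂ) (E := CVec (n + 1)) (ι := Fin (n + 1))
    (by simp) (Fin.cons w fun i : Fin n => EuclideanSpace.single i.castSucc 1)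

/-- `ν` is the isotropic law of a random unit vector: it lives on the unit sphere and is invariant
under all unitary maps. -/
structure IsIsotropicUnit {N : ℕ} (ν : Measure (CVec N)) : Prop where
  isProbabilityMeasure : IsProbabilityMeasure ν
  norm_eq_one : ∀ᵐ w ∂ν, ‖w‖ = 1
  map_eq : ∀ U : CVec N ≃ₗᵢ[ℂ] CVec N, ν.map U = ν

/-- The random quantities of the artificial noise scheme with `n + 1` transmit antennas, one antenna
at Bob and one at Eve, and random vector quantization with `B` feedback bits. -/
structure IsRVQSystem {Ω : Type*} [MeasurableSpace Ω] (μ : Measure Ω) {n B : ℕ}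
    (H G : Ω → Fin (n + 1) → ℂ) (V : Ω → Precoder (n + 1))
    (W : Fin (2 ^ B) → Ω → CVec (n + 1)) (j : Ω → Fin (2 ^ B)) : Prop where
  /-- The channels `H` (to Bob) and `G` (to Eve) have i.i.d. `𝒩_ℂ(0, 1)` entries. -/
  law_H : HasLaw H (Measure.pi fun _ => complexGaussian 1) μ
  law_G : HasLaw G (Measure.pi fun _ => complexGaussian 1) μ
  /-- The codewords are isotropic unit vectors. -/
  aemeasurable_W : ∀ i, AEMeasurable (W i) μ
  law_W : ∀ i, IsIsotropicUnit (μ.map (W i))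
  /-- The two channels and all codewords are mutually independent. -/
  indep_HG : IndepFun H G μ
  indep_W : iIndepFun W μ
  indep_HG_W : IndepFun (fun ω => (H ω, G ω)) (fun ω i => W i ω) μ
  /-- `V = [Ṽ, Z]` is unitary with `H Z = 0`. -/
  null_space : ∀ᵐ ω ∂μ, ∀ i : Fin n, rowMul (H ω) (V ω i.succ) = 0
  /-- Bob selects a codeword closest to `Ṽ`. -/
  selection : ∀ᵐ ω ∂μ, ∀ i,
    chordalDist (W (j ω) ω) (V ω 0) ^ 2 ≤ chordalDist (W i ω) (V ω 0) ^ 2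

/-- The instantaneous secrecy rate with perfect channel knowledge at the transmitter. -/
def perfectRate {Ω : Type*} {n : ℕ} (su sv sE : ℝ) (H G : Ω → Fin (n + 1) → ℂ)
    (V : Ω → Precoder (n + 1)) (ω : Ω) : ℝ :=
  secrecyRate su sv sE (H ω) (G ω) (V ω)

/-- The instantaneous secrecy rate with quantized channel knowledge: the transmitter precodes with
the Gram-Schmidt completion of the selected codeword. -/
def quantizedRate {Ω : Type*} {n B : ℕ} (su sv sE : ℝ) (H G : Ω → Fin (n + 1) → ℂ)
    (W : Fin (2 ^ B) → Ω → CVec (n + 1)) (j : Ω → Fin (2 ^ B)) (ω : Ω) : ℝ :=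
  secrecyRate su sv sE (H ω) (G ω) (gramSchmidtPrecoder (W (j ω) ω))

/-- The ergodic secrecy rate loss `E(R_S) - E(R_{S,Q})`. -/
def ergodicSecrecyRateLoss {Ω : Type*} [MeasurableSpace Ω] (μ : Measure Ω) {n B : ℕ}
    (su sv sE : ℝ) (H G : Ω → Fin (n + 1) → ℂ) (V : Ω → Precoder (n + 1))
    (W : Fin (2 ^ B) → Ω → CVec (n + 1)) (j : Ω → Fin (2 ^ B)) : ℝ :=
  (∫ ω, perfectRate su sv sE H G V ω ∂μ) - ∫ ω, quantizedRate su sv sE H G W j ω ∂μ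

end

/-! For fixed channels all signals are Gaussian. By unitarity of the precoder, each mutual
information depends only on the total gain `T = ‖h‖²` and the gain `a` along the information beam:
it equals `log (1 + a su / (sv (T - a) + s))`. The Gram–Schmidt completion therefore matters only
through its first column, the selected codeword.

Eve's terms vanish in the limit. Both beams are functions of `H` and the codebook, hence independent
of `G`, so Eve's gain along the beam has mean 1. By `log (1 + x) ≤ x` her expected rate is at most
`su / γ`, and `su = P / (1 + β n)` tends to 0.

For Bob, perfect knowledge gives `a = T`, quantized knowledge `a = T (1 - d)` with `d` the
quantization error. Two L¹ limits suffice. First, `su T → P / β`, since `T` has mean and variance `N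
= n + 1` while `su` is of order `1 / N`. Second, `d → D = 2 ^ (-Bbar)`: a single codeword has
distance at most `t` with probability `t ^ n`, so a union bound and independence give `P(d ≤ t) ≤ 2
^ B t ^ n` and `P(d > t) ≤ exp (-(2 ^ B t ^ n))`. As `2 ^ B t ^ n = exp (N (Bbar log 2 + log t +
o(1)))`, there is a sharp threshold at `t = D`.

Since `log (1 + ·)` is 1-Lipschitz on nonnegative reals, L¹ convergence passes to the expected
rates; `IsRVQSystem.abs_ergodicSecrecyRateLoss_sub_le` records the resulting error bound.

Neither `j` nor `V` is assumed measurable. Almost surely there are no ties, so the selected codeword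
agrees with a measurable function of `H` and the codebook; the first column of `V` is, up to phase,
the matched beam of `H`. -/

noncomputable section

/-! ### The complex Gaussian law -/

theorem MeasureTheory.MeasurePreserving.map_withDensity_comp {X Y : Type*} [MeasurableSpace X]
    [MeasurableSpace Y] {μ : Measure X} {ν : Measure Y} {e : X → Y} (he : MeasurePreserving e μ ν)
    {f : Y → ℝ≥0∞} (hf : Measurable f) :
    (μ.withDensity fun x => f (e x)).map e = ν.withDensity f := by
  ext s hs
  rw [Measure.map_apply he.measurable hs, withDensity_apply _ (he.measurable hs),
    withDensity_apply _ hs, he.setLIntegral_comp_preimage hs hf]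

instance isProbabilityMeasure_complexGaussian (v : ℝ) :
    IsProbabilityMeasure (complexGaussian v) := by
  unfold complexGaussian
  exact Measure.isProbabilityMeasure_map (MeasurableEquiv.measurable _).aemeasurable

theorem charFun_complexGaussian {v : ℝ} (hv : 0 ≤ v) (t : ℂ) :
    charFun (complexGaussian v) t = Complex.exp (-(v / 4 * ‖t‖ ^ 2 : ℝ)) := by
  rw [charFun_apply, complexGaussian, integral_map_equiv]
  have h1 : ∀ x : ℝ × ℝ, Complex.exp (inner ℝ (Complex.measurableEquivRealProd.symm x) t * Complex.I)
      = Complex.exp (t.re * x.1 * Complex.I) * Complex.exp (t.im * x.2 * Complex.I) := by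
    intro x
    rw [← Complex.exp_add]
    congr 1
    simp [Complex.inner, Complex.measurableEquivRealProd_symm_apply]
    ring
  simp_rw [h1]
  rw [integral_prod_mul (fun x : ℝ => Complex.exp (t.re * x * Complex.I))
    (fun x : ℝ => Complex.exp (t.im * x * Complex.I)), ← charFun_apply_real, ← charFun_apply_real,
    charFun_gaussianReal, charFun_gaussianReal, ← Complex.exp_add]
  congr 1
  have : ((v / 2).toNNReal : ℂ) = ((v / 2 : ℝ) : ℂ) := by
    exact congrArg Complex.ofReal (Real.coe_toNNReal _ (by positivity))
  rw [this, Complex.sq_norm, Complex.normSq_apply]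
  push_cast
  ring

theorem complexGaussian_map_const_mul {v : ℝ} (hv : 0 ≤ v) (c : ℂ) :
    (complexGaussian v).map (fun z => c * z) = complexGaussian (‖c‖ ^ 2 * v) := by
  have hm : Measurable fun z : ℂ => c * z := by fun_prop
  have := Measure.isProbabilityMeasure_map (μ := complexGaussian v) hm.aemeasurable
  apply Measure.ext_of_charFun
  ext t
  have h1 : charFun ((complexGaussian v).map (fun z => c * z)) t
      = charFun (complexGaussian v) ((starRingEnd ℂ) c * t) := by
    rw [charFun_apply, charFun_apply, integral_map hm.aemeasurable (by fun_prop)]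
    congr 1; ext z
    congr 3
    simp [Complex.inner]
    ring
  rw [h1, charFun_complexGaussian hv, charFun_complexGaussian (by positivity)]
  congr 3
  simp
  ring

theorem complexGaussian_map_add_prod {a b : ℝ} (ha : 0 ≤ a) (hb : 0 ≤ b) :
    ((complexGaussian a).prod (complexGaussian b)).map (fun p => p.1 + p.2)
      = complexGaussian (a + b) := by
  have := Measure.isProbabilityMeasure_map
    (μ := (complexGaussian a).prod (complexGaussian b)) (f := fun p : ℂ × ℂ => p.1 + p.2)
    (by fun_prop)
  apply Measure.ext_of_charFun
  rw [charFun_map_add_prod_eq_mul]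
  ext t
  simp only [Pi.mul_apply]
  rw [charFun_complexGaussian ha, charFun_complexGaussian hb,
    charFun_complexGaussian (by positivity), ← Complex.exp_add]
  congr 1
  push_cast
  ring

theorem complexGaussian_map_sum_pi {ι : Type*} [Fintype ι] {v : ℝ} (hv : 0 ≤ v) (c : ι → ℂ) :
    (Measure.pi fun _ : ι => complexGaussian v).map (fun g => ∑ i, c i * g i)
      = complexGaussian (v * ∑ i, ‖c i‖ ^ 2) := by
  have hm : Measurable fun g : ι → ℂ => ∑ i, c i * g i := by fun_prop
  have := Measure.isProbabilityMeasure_map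
    (μ := (Measure.pi fun _ : ι => complexGaussian v)) hm.aemeasurable
  apply Measure.ext_of_charFun
  ext t
  have h1 : (Measure.pi fun _ : ι => complexGaussian v).map (fun g => ∑ i, c i * g i)
      = (Measure.pi fun i : ι => complexGaussian (‖c i‖ ^ 2 * v)).map (fun g => ∑ i, g i) := by
    simp_rw [← complexGaussian_map_const_mul hv]
    rw [← Measure.pi_map_pi (fun i => by fun_prop), Measure.map_map (by fun_prop) (by fun_prop)]
    rfl
  rw [h1, charFun_map_sum_pi_eq_prod]
  rw [Finset.prod_apply]
  have h2 : ∀ i, charFun (complexGaussian (‖c i‖ ^ 2 * v)) t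
      = Complex.exp (-(‖c i‖ ^ 2 * v / 4 * ‖t‖ ^ 2 : ℝ)) := fun i =>
    charFun_complexGaussian (by positivity) t
  simp_rw [h2]
  rw [charFun_complexGaussian (by positivity), ← Complex.exp_sum]
  congr 1
  rw [Finset.sum_neg_distrib, ← Complex.ofReal_sum, ← Finset.sum_mul, ← Finset.sum_div,
    ← Finset.sum_mul]
  ring_nf

/-- The density of `complexGaussian v` with respect to Lebesgue measure. -/
def complexGaussianPDF (v : ℝ) (z : ℂ) : ℝ := (Real.pi * v)⁻¹ * Real.exp (-‖z‖ ^ 2 / v)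

theorem complexGaussianPDF_pos {v : ℝ} (hv : 0 < v) (z : ℂ) : 0 < complexGaussianPDF v z := by
  unfold complexGaussianPDF; positivity

@[fun_prop]
theorem measurable_complexGaussianPDF (v : ℝ) : Measurable (complexGaussianPDF v) := by
  unfold complexGaussianPDF; fun_prop

theorem complexGaussian_eq_withDensity {v : ℝ} (hv : 0 < v) :
    complexGaussian v = volume.withDensity fun z => ENNReal.ofReal (complexGaussianPDF v z) := by
  have h0 : (v / 2).toNNReal ≠ 0 := by simpa using hv
  rw [complexGaussian, gaussianReal_of_var_ne_zero _ h0,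
    prod_withDensity (measurable_gaussianPDF _ _) (measurable_gaussianPDF _ _),
    ← MeasurePreserving.map_withDensity_comp
      (Complex.volume_preserving_equiv_real_prod.symm Complex.measurableEquivRealProd)
      (by fun_prop)]
  congr 2
  ext x
  rw [gaussianPDF_def]
  simp only
  rw [← ENNReal.ofReal_mul (gaussianPDFReal_nonneg _ _ _)]
  congr 1
  rw [gaussianPDFReal, gaussianPDFReal, complexGaussianPDF, Real.coe_toNNReal _ (by positivity),
    Complex.measurableEquivRealProd_symm_apply, Complex.sq_norm, Complex.normSq_apply,
    mul_mul_mul_comm, ← mul_inv, Real.mul_self_sqrt (by positivity), ← Real.exp_add]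
  congr 2 <;> (field_simp; try ring)

theorem integral_complexGaussian_one (f : ℂ → ℝ) :
    ∫ z, f z ∂complexGaussian 1 = Real.pi⁻¹ * ∫ z, f z * Real.exp (-‖z‖ ^ 2) := by
  rw [complexGaussian_eq_withDensity one_pos,
    integral_withDensity_eq_integral_toReal_smul (by fun_prop) (by simp), ← integral_const_mul]
  congr 1; ext z
  rw [ENNReal.toReal_ofReal (complexGaussianPDF_pos one_pos z).le, complexGaussianPDF]
  simp
  ring

theorem integral_norm_sq_complexGaussian_one : ∫ z, ‖z‖ ^ 2 ∂complexGaussian 1 = 1 := by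
  have h := Complex.integral_rpow_mul_exp_neg_rpow (p := 2) (q := 2) (by norm_num) (by norm_num)
  simp only [Real.rpow_ofNat] at h
  rw [integral_complexGaussian_one, h, show ((2 : ℝ) + 2) / 2 = 2 by norm_num, Real.Gamma_two]
  field_simp

theorem integral_norm_pow_four_complexGaussian_one : ∫ z, ‖z‖ ^ 4 ∂complexGaussian 1 = 2 := by
  have h := Complex.integral_rpow_mul_exp_neg_rpow (p := 2) (q := 4) (by norm_num) (by norm_num)
  simp only [Real.rpow_ofNat] at h
  rw [integral_complexGaussian_one, h, show ((4 : ℝ) + 2) / 2 = 2 + 1 by norm_num,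
    Real.Gamma_add_one (by norm_num), Real.Gamma_two]
  field_simp

theorem integrable_norm_pow_four_complexGaussian_one :
    Integrable (fun z : ℂ => ‖z‖ ^ 4) (complexGaussian 1) :=
  Integrable.of_integral_ne_zero
    (integral_norm_pow_four_complexGaussian_one.trans_ne two_ne_zero)

theorem integral_exp_neg_mul_norm_sq_complexGaussian_one {s : ℝ} (hs : 0 ≤ s) :
    ∫ z, Real.exp (-s * ‖z‖ ^ 2) ∂complexGaussian 1 = (1 + s)⁻¹ := by
  have h := Complex.integral_exp_neg_mul_rpow (p := 2) (b := 1 + s) (by norm_num) (by positivity)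
  simp only [Real.rpow_ofNat] at h
  rw [integral_complexGaussian_one]
  simp_rw [← Real.exp_add]
  rw [show (fun z : ℂ => Real.exp (-s * ‖z‖ ^ 2 + -‖z‖ ^ 2)) =
    fun z : ℂ => Real.exp (-(1 + s) * ‖z‖ ^ 2) by ext; ring_nf, h]
  norm_num [Real.Gamma_two, Real.rpow_neg_one]

/-- The squared modulus is exponential with mean 1; polar coordinates reduce the tail to integrating
`y exp (-y²)`. -/
theorem complexGaussian_one_real_norm_sq_ge {x : ℝ} (hx : 0 ≤ x) :
    (complexGaussian 1).real {z | x ≤ ‖z‖ ^ 2} = Real.exp (-x) := by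
  have hms : MeasurableSet {z : ℂ | x ≤ ‖z‖ ^ 2} := measurableSet_le (by fun_prop) (by fun_prop)
  rw [← integral_indicator_one hms, integral_complexGaussian_one]
  have h1 : (fun z : ℂ => ({z : ℂ | x ≤ ‖z‖ ^ 2}.indicator 1 z : ℝ) * Real.exp (-‖z‖ ^ 2))
      = fun z : ℂ => (fun r : ℝ => ({r : ℝ | x ≤ r ^ 2}.indicator (fun r => Real.exp (-r ^ 2)) r)) ‖z‖ := by
    ext z
    by_cases h : x ≤ ‖z‖ ^ 2 <;> simp [h]
  rw [h1, integral_fun_norm_addHaar (volume : Measure ℂ)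
    (fun r : ℝ => ({r : ℝ | x ≤ r ^ 2}.indicator (fun r => Real.exp (-r ^ 2)) r))]
  have h2 : ∫ y in Set.Ioi (0 : ℝ), y ^ (Module.finrank ℝ ℂ - 1) •
      ({r : ℝ | x ≤ r ^ 2}.indicator (fun r => Real.exp (-r ^ 2)) y)
      = ∫ y in Set.Ioi (√x), y * Real.exp (-y ^ 2) := by
    -- The closed half-line matches the condition `x ≤ y ^ 2` pointwise for `y > 0`; at `y = 0` the
    -- factor `y` vanishes.
    rw [← integral_Ici_eq_integral_Ioi (x := √x)]
    rw [← integral_indicator measurableSet_Ioi, ← integral_indicator measurableSet_Ici]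
    congr 1; ext y
    rcases lt_trichotomy y 0 with hy | rfl | hy
    · have h3 : ¬ √x ≤ y := fun h => by linarith [Real.sqrt_nonneg x]
      simp [Set.indicator, hy.not_gt, h3]
    · simp [Set.indicator]
    · have : √x ≤ y ↔ x ≤ y ^ 2 := Real.sqrt_le_left hy.le
      simp [Set.indicator, hy, this]
  rw [h2]
  have h3 : ∫ y in Set.Ioi (√x), y * Real.exp (-y ^ 2) = Real.exp (-x) / 2 := by
    have hd : ∀ y ∈ Set.Ici (√x), HasDerivAt (fun y : ℝ => -(Real.exp (-y ^ 2) / 2))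
        (y * Real.exp (-y ^ 2)) y := by
      intro y _
      have := (((hasDerivAt_pow 2 y).neg).exp.div_const 2).neg
      refine this.congr_deriv ?_
      norm_num
      ring
    have hl : Tendsto (fun y : ℝ => -(Real.exp (-y ^ 2) / 2)) atTop (𝓝 0) := by
      have : Tendsto (fun y : ℝ => Real.exp (-y ^ 2)) atTop (𝓝 0) :=
        Real.tendsto_exp_neg_atTop_nhds_zero.comp (tendsto_pow_atTop two_ne_zero)
      simpa using (this.div_const 2).neg
    rw [integral_Ioi_of_hasDerivAt_of_nonneg' hd (fun y hy => ?_) hl]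
    · rw [Real.sq_sqrt hx]; ring
    · exact mul_nonneg ((Real.sqrt_nonneg x).trans (le_of_lt hy)) (Real.exp_nonneg _)
  rw [h3, measureReal_def, Complex.volume_ball]
  simp
  field_simp

theorem complexGaussian_eq_map_one {v : ℝ} (hv : 0 ≤ v) :
    complexGaussian v = (complexGaussian 1).map (fun z => (√v : ℂ) * z) := by
  rw [complexGaussian_map_const_mul zero_le_one]
  congr 1
  simp [Real.sq_sqrt hv]

theorem integrable_norm_sq_complexGaussian {v : ℝ} (hv : 0 ≤ v) :
    Integrable (fun z : ℂ => ‖z‖ ^ 2) (complexGaussian v) := by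
  rw [complexGaussian_eq_map_one hv, integrable_map_measure (by fun_prop) (by fun_prop)]
  have := (Integrable.of_integral_ne_zero
    (integral_norm_sq_complexGaussian_one.trans_ne one_ne_zero)).const_mul v
  refine this.congr (ae_of_all _ fun z => ?_)
  simp [mul_pow, Real.sq_sqrt hv]

theorem integral_norm_sq_complexGaussian {v : ℝ} (hv : 0 ≤ v) :
    ∫ z, ‖z‖ ^ 2 ∂complexGaussian v = v := by
  rw [complexGaussian_eq_map_one hv, integral_map (by fun_prop) (by fun_prop)]
  simp [mul_pow, Real.sq_sqrt hv, integral_const_mul, integral_norm_sq_complexGaussian_one]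

/-! ### Mutual information of a Gaussian channel -/

/-- The joint law of `u ∼ 𝒩_ℂ(0, su)` and `c u + w`, with `w ∼ 𝒩_ℂ(0, τ)` independent of `u`. -/
def scalarChannelLaw (su τ : ℝ) (c : ℂ) : Measure (ℂ × ℂ) :=
  ((complexGaussian su).prod (complexGaussian τ)).map fun p => (p.1, c * p.1 + p.2)

instance (su τ : ℝ) (c : ℂ) : IsProbabilityMeasure (scalarChannelLaw su τ c) := by
  unfold scalarChannelLaw
  exact Measure.isProbabilityMeasure_map (by fun_prop)

theorem fst_scalarChannelLaw (su τ : ℝ) (c : ℂ) :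
    (scalarChannelLaw su τ c).fst = complexGaussian su := by
  rw [Measure.fst, scalarChannelLaw, Measure.map_map (by fun_prop) (by fun_prop)]
  exact Measure.fst_prod

theorem snd_scalarChannelLaw {su τ : ℝ} (hsu : 0 ≤ su) (hτ : 0 ≤ τ) (c : ℂ) :
    (scalarChannelLaw su τ c).snd = complexGaussian (‖c‖ ^ 2 * su + τ) := by
  rw [Measure.snd, scalarChannelLaw, Measure.map_map (by fun_prop) (by fun_prop),
    ← complexGaussian_map_add_prod (by positivity) hτ, ← complexGaussian_map_const_mul hsu]
  conv_rhs => rw [← Measure.map_id (μ := complexGaussian τ)]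
  rw [Measure.map_prod_map _ _ (by fun_prop) (by fun_prop),
    Measure.map_map (by fun_prop) (by fun_prop)]
  rfl

/-- The shear `(u, w) ↦ (u, c u + w)` preserves the product of the law of `u` with Lebesgue measure,
so only the noise needs a density and `su = 0` is allowed. -/
theorem scalarChannelLaw_eq_withDensity {su τ σ : ℝ} (hτ : 0 < τ) (hσ : 0 < σ) (c : ℂ) :
    scalarChannelLaw su τ c = ((complexGaussian su).prod (complexGaussian σ)).withDensity
      fun p => ENNReal.ofReal (complexGaussianPDF τ (p.2 - c * p.1) / complexGaussianPDF σ p.2) := by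
  have hS : MeasurePreserving (fun p : ℂ × ℂ => (p.1, c * p.1 + p.2))
      ((complexGaussian su).prod volume) ((complexGaussian su).prod volume) :=
    (MeasurePreserving.id _).skew_product (g := fun u z => c * u + z) (by fun_prop)
      (ae_of_all _ fun u => map_add_left_eq_self _ _)
  rw [scalarChannelLaw, complexGaussian_eq_withDensity hτ, complexGaussian_eq_withDensity hσ,
    prod_withDensity_right (by fun_prop), prod_withDensity_right (by fun_prop),
    ← withDensity_mul _ (by fun_prop) (by fun_prop)]
  have := hS.map_withDensity_comp
    (f := fun p => ENNReal.ofReal (complexGaussianPDF τ (p.2 - c * p.1))) (by fun_prop)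
  simp only [add_sub_cancel_left] at this
  rw [this]
  congr 1
  ext p
  have hp := complexGaussianPDF_pos hσ p.2
  rw [Pi.mul_apply, ← ENNReal.ofReal_mul hp.le]
  congr 1
  field_simp

theorem log_complexGaussianPDF_div {τ σ : ℝ} (hτ : 0 < τ) (hσ : 0 < σ) (w z : ℂ) :
    Real.log (complexGaussianPDF τ w / complexGaussianPDF σ z)
      = Real.log (σ / τ) - ‖w‖ ^ 2 / τ + ‖z‖ ^ 2 / σ := by
  have hπ := Real.pi_pos
  rw [Real.log_div (complexGaussianPDF_pos hτ w).ne' (complexGaussianPDF_pos hσ z).ne',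
    complexGaussianPDF, complexGaussianPDF, Real.log_mul (by positivity) (by positivity),
    Real.log_mul (by positivity) (by positivity), Real.log_exp, Real.log_exp, Real.log_inv,
    Real.log_inv, Real.log_mul hπ.ne' hτ.ne', Real.log_mul hπ.ne' hσ.ne',
    Real.log_div hσ.ne' hτ.ne']
  ring

/-- The log-likelihood ratio is `log (σ / τ)` plus two normalized quadratic terms, whose
expectations `-1` and `1` cancel. -/
theorem mutualInfo_scalarChannelLaw {su τ : ℝ} (hsu : 0 ≤ su) (hτ : 0 < τ) (c : ℂ) :
    mutualInfo (scalarChannelLaw su τ c) ≠ ∞ ∧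
    (mutualInfo (scalarChannelLaw su τ c)).toReal = Real.log (1 + ‖c‖ ^ 2 * su / τ) := by
  set σ := ‖c‖ ^ 2 * su + τ with hσdef
  have hσ : 0 < σ := by positivity
  rw [mutualInfo, fst_scalarChannelLaw, snd_scalarChannelLaw hsu hτ.le]
  set κ := (complexGaussian su).prod (complexGaussian σ) with hκ
  have hd := scalarChannelLaw_eq_withDensity (su := su) hτ hσ c
  have hac : scalarChannelLaw su τ c ≪ κ := by
    rw [hd]; exact withDensity_absolutelyContinuous _ _
  have hllr : llr (scalarChannelLaw su τ c) κ =ᵐ[scalarChannelLaw su τ c]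
      fun p => Real.log (σ / τ) - ‖p.2 - c * p.1‖ ^ 2 / τ + ‖p.2‖ ^ 2 / σ := by
    have h := Measure.rnDeriv_withDensity κ (f := fun p : ℂ × ℂ => ENNReal.ofReal
      (complexGaussianPDF τ (p.2 - c * p.1) / complexGaussianPDF σ p.2)) (by fun_prop)
    rw [← hd] at h
    filter_upwards [hac.ae_eq h] with p hp
    rw [llr, hp, ENNReal.toReal_ofReal (div_pos (complexGaussianPDF_pos hτ _)
      (complexGaussianPDF_pos hσ _)).le, log_complexGaussianPDF_div hτ hσ]
  have i1 : Integrable (fun p : ℂ × ℂ => ‖p.2 - c * p.1‖ ^ 2) (scalarChannelLaw su τ c) := by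
    rw [scalarChannelLaw, integrable_map_measure (by fun_prop) (by fun_prop)]
    simpa [Function.comp_def] using (integrable_norm_sq_complexGaussian hτ.le).comp_snd
      (complexGaussian su)
  have e1 : ∫ p, ‖p.2 - c * p.1‖ ^ 2 ∂scalarChannelLaw su τ c = τ := by
    rw [scalarChannelLaw, integral_map (by fun_prop) (by fun_prop)]
    simp only [add_sub_cancel_left]
    rw [integral_fun_snd (fun z : ℂ => ‖z‖ ^ 2), integral_norm_sq_complexGaussian hτ.le]
    simp
  have i2 : Integrable (fun p : ℂ × ℂ => ‖p.2‖ ^ 2) (scalarChannelLaw su τ c) := by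
    have := integrable_norm_sq_complexGaussian hσ.le
    rw [hσdef, ← snd_scalarChannelLaw hsu hτ.le c, Measure.snd,
      integrable_map_measure (by fun_prop) (by fun_prop)] at this
    exact this
  have e2 : ∫ p, ‖p.2‖ ^ 2 ∂scalarChannelLaw su τ c = σ := by
    have := integral_norm_sq_complexGaussian hσ.le
    rw [hσdef, ← snd_scalarChannelLaw hsu hτ.le c, Measure.snd,
      integral_map (by fun_prop) (by fun_prop)] at this
    exact this
  have i3 : Integrable (fun p : ℂ × ℂ => Real.log (σ / τ) - ‖p.2 - c * p.1‖ ^ 2 / τ)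
      (scalarChannelLaw su τ c) := (integrable_const _).sub (i1.div_const τ)
  refine ⟨InformationTheory.klDiv_ne_top hac
    ((integrable_congr hllr).2 (i3.add (i2.div_const σ))), ?_⟩
  rw [InformationTheory.toReal_klDiv_of_measure_eq hac (by simp), integral_congr_ae hllr,
    integral_add i3 (i2.div_const σ), integral_sub (integrable_const _) (i1.div_const τ),
    integral_div, integral_div, e1, e2, div_self hτ.ne', div_self hσ.ne']
  simp only [integral_const, probReal_univ, smul_eq_mul, one_mul, sub_add_cancel]
  congr 1
  rw [hσdef, add_div, div_self hτ.ne', add_comm]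

/-! ### Reduction of the vector channel to a scalar channel -/

theorem rowMul_smul {N : ℕ} (h : Fin N → ℂ) (a : ℂ) (x : CVec N) :
    rowMul h (a • x) = a * rowMul h x := by
  simp only [rowMul, Finset.mul_sum, PiLp.smul_apply, smul_eq_mul]
  exact Finset.sum_congr rfl fun i _ => by ring

theorem rowMul_add {N : ℕ} (h : Fin N → ℂ) (x y : CVec N) :
    rowMul h (x + y) = rowMul h x + rowMul h y := by
  simp [rowMul, mul_add, Finset.sum_add_distrib]

theorem rowMul_sum {N : ℕ} {ι : Type*} (s : Finset ι) (h : Fin N → ℂ) (x : ι → CVec N) :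
    rowMul h (∑ i ∈ s, x i) = ∑ i ∈ s, rowMul h (x i) := by
  simp only [rowMul, WithLp.ofLp_sum, Finset.sum_apply, Finset.mul_sum]
  exact Finset.sum_comm

theorem rowMul_transmit {n : ℕ} (h : Fin (n + 1) → ℂ) (V : Precoder (n + 1)) (u : ℂ)
    (v : Fin n → ℂ) : rowMul h (transmit V u v)
      = rowMul h (V 0) * u + ∑ i, rowMul h (V i.succ) * v i := by
  simp [transmit, rowMul_add, rowMul_sum, rowMul_smul, mul_comm]

theorem channelLaw_eq_scalarChannelLaw {n : ℕ} (su : ℝ) {sv s : ℝ} (hsv : 0 ≤ sv)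
    (hs : 0 ≤ s) (h : Fin (n + 1) → ℂ) (V : Precoder (n + 1)) :
    channelLaw su sv s h V = scalarChannelLaw su
      (sv * ∑ i : Fin n, ‖rowMul h (V i.succ)‖ ^ 2 + s) (rowMul h (V 0)) := by
  have hm1 : Measurable fun v : Fin n → ℂ => ∑ i, rowMul h (V i.succ) * v i := by fun_prop
  have h1 : ((Measure.pi fun _ : Fin n => complexGaussian sv).prod (complexGaussian s)).map
      (fun q => (∑ i, rowMul h (V i.succ) * q.1 i) + q.2)
      = complexGaussian (sv * ∑ i : Fin n, ‖rowMul h (V i.succ)‖ ^ 2 + s) := by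
    rw [← complexGaussian_map_add_prod (by positivity) hs, ← complexGaussian_map_sum_pi hsv]
    conv_rhs => rw [← Measure.map_id (μ := complexGaussian s)]
    rw [Measure.map_prod_map _ _ hm1 (by fun_prop), Measure.map_map (by fun_prop) (by fun_prop)]
    rfl
  rw [scalarChannelLaw, ← h1]
  conv_rhs => rw [← Measure.map_id (μ := complexGaussian su)]
  rw [Measure.map_prod_map _ _ (by fun_prop) (by fun_prop),
    Measure.map_map (by fun_prop) (by fun_prop), channelLaw]
  congr 1
  ext p
  · rfl
  · simp [rowMul_transmit, add_assoc]

/-- The row vector `h` as the column vector of its conjugates, so that `h x` is an inner product. -/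
def conjVec {N : ℕ} (h : Fin N → ℂ) : CVec N := WithLp.toLp 2 fun i => star (h i)

theorem rowMul_eq_inner {N : ℕ} (h : Fin N → ℂ) (x : CVec N) :
    rowMul h x = inner ℂ (conjVec h) x := by
  simp [rowMul, conjVec, PiLp.inner_apply, mul_comm]

theorem norm_conjVec_sq {N : ℕ} (h : Fin N → ℂ) : ‖conjVec h‖ ^ 2 = ∑ i, ‖h i‖ ^ 2 := by
  simp [EuclideanSpace.norm_sq_eq, conjVec]

theorem sum_norm_rowMul_sq {N : ℕ} (h : Fin N → ℂ) (V : Precoder N) :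
    ∑ i, ‖rowMul h (V i)‖ ^ 2 = ∑ i, ‖h i‖ ^ 2 := by
  rw [← norm_conjVec_sq h]
  simp_rw [rowMul_eq_inner]
  exact V.sum_sq_norm_inner_left (conjVec h)

/-- The mutual information of the artificial noise channel, where `T = ‖h‖ ^ 2` is the total
channel gain and `a = |h Ṽ| ^ 2` the gain along the information beam. -/
def beamRate (su sv s T a : ℝ) : ℝ := Real.log (1 + a * su / (sv * (T - a) + s))

/-- Artificial and receiver noise add up to one Gaussian; by Parseval the former carries the gain `T
- a`, whatever the completion of the beam. -/
theorem mutualInfo_channelLaw {n : ℕ} {su sv s : ℝ} (hsu : 0 ≤ su) (hsv : 0 ≤ sv) (hs : 0 < s)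
    (h : Fin (n + 1) → ℂ) (V : Precoder (n + 1)) :
    mutualInfo (channelLaw su sv s h V) ≠ ∞ ∧
    (mutualInfo (channelLaw su sv s h V)).toReal
      = beamRate su sv s (∑ i, ‖h i‖ ^ 2) (‖rowMul h (V 0)‖ ^ 2) := by
  have hT : ∑ i : Fin n, ‖rowMul h (V i.succ)‖ ^ 2
      = ∑ i, ‖h i‖ ^ 2 - ‖rowMul h (V 0)‖ ^ 2 := by
    rw [← sum_norm_rowMul_sq h V, Fin.sum_univ_succ]
    ring
  rw [channelLaw_eq_scalarChannelLaw su hsv hs.le, beamRate, ← hT]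
  exact mutualInfo_scalarChannelLaw hsu (by positivity) _

theorem secrecyRate_eq {n : ℕ} {su sv sE : ℝ} (hsu : 0 ≤ su) (hsv : 0 ≤ sv) (hsE : 0 < sE)
    (h g : Fin (n + 1) → ℂ) (V : Precoder (n + 1)) :
    secrecyRate su sv sE h g V
      = beamRate su sv 1 (∑ i, ‖h i‖ ^ 2) (‖rowMul h (V 0)‖ ^ 2)
        - beamRate su sv sE (∑ i, ‖g i‖ ^ 2) (‖rowMul g (V 0)‖ ^ 2) := by
  rw [secrecyRate, (mutualInfo_channelLaw hsu hsv one_pos h V).2,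
    (mutualInfo_channelLaw hsu hsv hsE g V).2]

/-! ### Isotropic unit vectors -/

/-- The law of a vector with i.i.d. standard complex Gaussian entries. -/
abbrev stdGaussianVec (N : ℕ) : Measure (Fin N → ℂ) := Measure.pi fun _ => complexGaussian 1

@[fun_prop]
theorem Measurable.rowMul {N : ℕ} {X : Type*} [MeasurableSpace X] {f : X → Fin N → ℂ}
    {g : X → CVec N} (hf : Measurable f) (hg : Measurable g) :
    Measurable fun x => rowMul (f x) (g x) := by
  unfold _root_.rowMul; fun_prop

theorem gramSchmidtPrecoder_zero {n : ℕ} {w : CVec (n + 1)} (hw : ‖w‖ = 1) :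
    gramSchmidtPrecoder w 0 = w := by
  have h0 : InnerProductSpace.gramSchmidtNormed ℂ
      (Fin.cons w fun i : Fin n => EuclideanSpace.single i.castSucc (1 : ℂ) :
        Fin (n + 1) → CVec (n + 1)) 0 = w := by
    have : InnerProductSpace.gramSchmidt ℂ
      (Fin.cons w fun i : Fin n => EuclideanSpace.single i.castSucc (1 : ℂ) :
        Fin (n + 1) → CVec (n + 1)) 0 = w := by
      rw [← bot_eq_zero, InnerProductSpace.gramSchmidt_bot, bot_eq_zero, Fin.cons_zero]
    rw [InnerProductSpace.gramSchmidtNormed, this, hw]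
    simp
  rw [gramSchmidtPrecoder, InnerProductSpace.gramSchmidtOrthonormalBasis_apply, h0]
  rw [h0]
  rintro rfl
  simp at hw

theorem exists_linearIsometryEquiv_apply_eq {n : ℕ} {x y : CVec (n + 1)} (hx : ‖x‖ = 1)
    (hy : ‖y‖ = 1) : ∃ U : CVec (n + 1) ≃ₗᵢ[ℂ] CVec (n + 1), U x = y := by
  refine ⟨(gramSchmidtPrecoder x).equiv (gramSchmidtPrecoder y) (Equiv.refl _), ?_⟩
  have := (gramSchmidtPrecoder x).equiv_apply_basis (gramSchmidtPrecoder y) (Equiv.refl _) 0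
  rwa [Equiv.refl_apply, gramSchmidtPrecoder_zero hx, gramSchmidtPrecoder_zero hy] at this

theorem charFun_stdGaussianVec_map_toLp {N : ℕ} (t : CVec N) :
    charFun ((stdGaussianVec N).map (WithLp.toLp 2)) t
      = Complex.exp (-(1 / 4 * ‖t‖ ^ 2 : ℝ)) := by
  rw [charFun_pi]
  simp_rw [charFun_complexGaussian zero_le_one]
  rw [← Complex.exp_sum, Finset.sum_neg_distrib, ← Complex.ofReal_sum, ← Finset.mul_sum,
    EuclideanSpace.norm_sq_eq]

/-- Unitary invariance: the characteristic function of the Gaussian vector depends only on the norm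
of its argument. -/
theorem measurePreserving_rowMul_basis {N : ℕ} (V : Precoder N) :
    MeasurePreserving (fun (g : Fin N → ℂ) i => rowMul g (V i))
      (stdGaussianVec N) (stdGaussianVec N) := by
  have hm : Measurable fun (g : Fin N → ℂ) i => rowMul g (V i) := by
    fun_prop
  refine ⟨hm, ?_⟩
  have hp := Measure.isProbabilityMeasure_map (μ := stdGaussianVec N) hm.aemeasurable
  have htm : Measurable (WithLp.toLp 2 : (Fin N → ℂ) → CVec N) := WithLp.measurable_toLp 2 _
  have hinj : Function.Injective (Measure.map (WithLp.toLp 2 : (Fin N → ℂ) → CVec N)) :=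
    (MeasurableEquiv.toLp 2 (Fin N → ℂ)).map_measurableEquiv_injective
  apply hinj
  have hp1 := Measure.isProbabilityMeasure_map (μ := stdGaussianVec N) htm.aemeasurable
  have hp2 := Measure.isProbabilityMeasure_map
    (μ := (stdGaussianVec N).map fun g i => rowMul g (V i)) htm.aemeasurable
  apply Measure.ext_of_charFun
  ext t
  -- The adjoint of `g ↦ (g V i)ᵢ` sends `t` to `∑ tᵢ conj (V i)`; the two conjugations occur
  -- because `rowMul` is bilinear.
  set s : CVec N := conjVec (V.repr.symm (conjVec t)) with hs
  have hn : ‖s‖ = ‖t‖ := by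
    have h1 : ∀ x : CVec N, ‖conjVec x‖ = ‖x‖ := fun x => by
      rw [← sq_eq_sq₀ (norm_nonneg _) (norm_nonneg _), norm_conjVec_sq, EuclideanSpace.norm_sq_eq]
    rw [hs, h1, LinearIsometryEquiv.norm_map, h1]
  have h2 : charFun (((stdGaussianVec N).map fun g i => rowMul g (V i)).map (WithLp.toLp 2)) t
      = charFun ((stdGaussianVec N).map (WithLp.toLp 2)) s := by
    rw [charFun_apply, charFun_apply, Measure.map_map htm hm, integral_map
      (htm.comp hm).aemeasurable (by fun_prop), integral_map htm.aemeasurable (by fun_prop)]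
    congr 1; ext g
    congr 3
    have : inner ℂ (WithLp.toLp 2 (fun i => rowMul g (V i)) : CVec N) t
        = inner ℂ (WithLp.toLp 2 g : CVec N) s := by
      have h3 : V.repr.symm (conjVec t) = ∑ i, conjVec t i • V i :=
        (V.sum_repr_symm (conjVec t)).symm
      rw [hs, h3]
      simp only [PiLp.inner_apply, rowMul, conjVec, RCLike.inner_apply, map_sum, map_mul,
        Finset.mul_sum, Finset.sum_mul, WithLp.ofLp_sum, WithLp.ofLp_smul, Finset.sum_apply,
        Pi.smul_apply, smul_eq_mul, star_sum, star_mul', RCLike.star_def, starRingEnd_self_apply]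
      rw [Finset.sum_comm]
      exact Finset.sum_congr rfl fun i _ => Finset.sum_congr rfl fun j _ => by ring
    have h4 : ∀ x y : CVec N, inner ℝ x y = (inner ℂ x y).re := fun x y => by
      simp [PiLp.inner_apply, Complex.inner]
    rw [h4, h4]
    exact congrArg Complex.re this
  rw [h2, charFun_stdGaussianVec_map_toLp, charFun_stdGaussianVec_map_toLp, hn]

/-- With `s = (1 - t) / t` the event says that `‖g 0‖²` is at least `s` times the sum of the other
squared moduli. Conditioning on these, the exponential tail factors into `n` Laplace transforms `(1
+ s)⁻¹ = t`. -/
theorem stdGaussianVec_real_head_ge {n : ℕ} {t : ℝ} (ht0 : 0 < t) (ht1 : t ≤ 1) :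
    (stdGaussianVec (n + 1)).real {g | (1 - t) * ∑ i, ‖g i‖ ^ 2 ≤ ‖g 0‖ ^ 2} = t ^ n := by
  have hmp := measurePreserving_piFinSuccAbove (fun _ : Fin (n + 1) => complexGaussian 1) 0
  set A : Set (ℂ × (Fin n → ℂ)) := {p | (1 - t) / t * ∑ i, ‖p.2 i‖ ^ 2 ≤ ‖p.1‖ ^ 2} with hA
  have hAm : MeasurableSet A := measurableSet_le (by fun_prop) (by fun_prop)
  have h1 : {g : Fin (n + 1) → ℂ | (1 - t) * ∑ i, ‖g i‖ ^ 2 ≤ ‖g 0‖ ^ 2}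
      = (MeasurableEquiv.piFinSuccAbove (fun _ : Fin (n + 1) => ℂ) 0) ⁻¹' A := by
    ext g
    have : (1 - t) * ∑ i : Fin (n + 1), ‖g i‖ ^ 2 ≤ ‖g 0‖ ^ 2 ↔
        (1 - t) / t * ∑ i : Fin n, ‖g i.succ‖ ^ 2 ≤ ‖g 0‖ ^ 2 := by
      rw [Fin.sum_univ_succ, div_mul_eq_mul_div, div_le_iff₀ ht0]
      constructor <;> intro h <;> linarith
    simpa [hA, MeasurableEquiv.piFinSuccAbove_apply, Fin.removeNth, Fin.insertNthEquiv, Fin.tail] using this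
  rw [h1, hmp.measureReal_preimage hAm.nullMeasurableSet]
  have hs : 0 ≤ (1 - t) / t := div_nonneg (by linarith) ht0.le
  rw [← integral_indicator_one hAm, integral_prod_symm
    (A.indicator 1) ((integrable_const (1 : ℝ)).indicator hAm)]
  have h2 : ∀ y : Fin n → ℂ, ∫ x, A.indicator (1 : ℂ × (Fin n → ℂ) → ℝ) (x, y) ∂complexGaussian 1
      = ∏ i, Real.exp (-((1 - t) / t) * ‖y i‖ ^ 2) := by
    intro y
    have h3 := complexGaussian_one_real_norm_sq_ge
      (x := (1 - t) / t * ∑ i, ‖y i‖ ^ 2) (by positivity)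
    rw [← integral_indicator_one (measurableSet_le (by fun_prop) (by fun_prop))] at h3
    rw [← Real.exp_sum, ← Finset.mul_sum, neg_mul, ← h3]
    rfl
  simp_rw [h2]
  rw [integral_fintype_prod_eq_prod (fun _ (z : ℂ) => Real.exp (-((1 - t) / t) * ‖z‖ ^ 2))]
  simp_rw [integral_exp_neg_mul_norm_sq_complexGaussian_one hs]
  rw [Finset.prod_const, Finset.card_univ, Fintype.card_fin]
  congr 1
  field_simp
  ring

theorem stdGaussianVec_real_rowMul_ge {n : ℕ} {w : CVec (n + 1)} (hw : ‖w‖ = 1) {t : ℝ}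
    (ht0 : 0 < t) (ht1 : t ≤ 1) :
    (stdGaussianVec (n + 1)).real {g | (1 - t) * ∑ i, ‖g i‖ ^ 2 ≤ ‖rowMul g w‖ ^ 2} = t ^ n := by
  have hA : MeasurableSet {g : Fin (n + 1) → ℂ | (1 - t) * ∑ i, ‖g i‖ ^ 2 ≤ ‖g 0‖ ^ 2} :=
    measurableSet_le (by fun_prop) (by fun_prop)
  rw [← stdGaussianVec_real_head_ge ht0 ht1,
    ← (measurePreserving_rowMul_basis (gramSchmidtPrecoder w)).measureReal_preimage
      hA.nullMeasurableSet]
  congr 1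
  ext g
  rw [Set.preimage_ofPred_eq, Set.mem_ofPred_eq, Set.mem_ofPred_eq, sum_norm_rowMul_sq]
  beta_reduce
  rw [gramSchmidtPrecoder_zero hw]

theorem ae_stdGaussianVec_sum_pos (n : ℕ) :
    ∀ᵐ g ∂stdGaussianVec (n + 1), 0 < ∑ i, ‖g i‖ ^ 2 := by
  have hz : complexGaussian 1 {0} = 0 := by
    rw [complexGaussian_eq_withDensity one_pos]
    exact withDensity_absolutelyContinuous _ _ (measure_singleton 0)
  have h0 : ∀ᵐ g ∂stdGaussianVec (n + 1), g 0 ≠ 0 :=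
    (Measure.quasiMeasurePreserving_eval (fun _ : Fin (n + 1) => complexGaussian 1) 0).ae
      (p := fun z => z ≠ 0) (by rw [ae_iff]; simpa using hz)
  filter_upwards [h0] with g hg
  exact Finset.sum_pos' (fun i _ => by positivity) ⟨0, Finset.mem_univ _, by positivity⟩

/-- A unitary map carrying the direction of `h` to that of `g` preserves `ν` and matches the two
events. -/
theorem IsIsotropicUnit.measure_rowMul_ge_congr {n : ℕ} {ν : Measure (CVec (n + 1))}
    (hν : IsIsotropicUnit ν) {g h : Fin (n + 1) → ℂ} (hg : 0 < ∑ i, ‖g i‖ ^ 2)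
    (hh : 0 < ∑ i, ‖h i‖ ^ 2) (t : ℝ) :
    ν {w | (1 - t) * ∑ i, ‖g i‖ ^ 2 ≤ ‖rowMul g w‖ ^ 2}
      = ν {w | (1 - t) * ∑ i, ‖h i‖ ^ 2 ≤ ‖rowMul h w‖ ^ 2} := by
  have hg' : 0 < ‖conjVec g‖ := by
    rw [← norm_conjVec_sq] at hg; exact (sq_pos_iff.1 hg).lt_of_le' (norm_nonneg _)
  have hh' : 0 < ‖conjVec h‖ := by
    rw [← norm_conjVec_sq] at hh; exact (sq_pos_iff.1 hh).lt_of_le' (norm_nonneg _)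
  obtain ⟨U, hU⟩ := exists_linearIsometryEquiv_apply_eq
    (x := ((‖conjVec h‖⁻¹ : ℝ) : ℂ) • conjVec h) (y := ((‖conjVec g‖⁻¹ : ℝ) : ℂ) • conjVec g)
    (by rw [norm_smul]; simp [hh'.ne']) (by rw [norm_smul]; simp [hg'.ne'])
  conv_lhs => rw [← hν.map_eq U]
  rw [Measure.map_apply U.continuous.measurable (measurableSet_le (by fun_prop) (by fun_prop))]
  congr 1
  ext w
  have hin : (‖conjVec g‖⁻¹ : ℝ) * ‖rowMul g (U w)‖ = ‖conjVec h‖⁻¹ * ‖rowMul h w‖ := by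
    have := congrArg norm (U.inner_map_map (((‖conjVec h‖⁻¹ : ℝ) : ℂ) • conjVec h) w)
    rw [hU, inner_smul_left, inner_smul_left, ← rowMul_eq_inner, ← rowMul_eq_inner] at this
    simpa using this
  simp only [Set.mem_ofPred_eq, Set.preimage_ofPred_eq, ← norm_conjVec_sq]
  have e1 : ‖rowMul g (U w)‖ = ‖conjVec g‖ * (‖conjVec h‖⁻¹ * ‖rowMul h w‖) := by
    rw [← hin]; field_simp
  rw [e1, mul_pow, mul_pow, mul_comm, mul_le_mul_iff_right₀ (by positivity), inv_pow,
    inv_mul_eq_div, le_div_iff₀ (by positivity)]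

/-- For an isotropic unit vector `w` in `ℂ ^ (n + 1)`, the chordal distance between `w` and any
fixed direction has distribution function `t ^ n`. -/
theorem IsIsotropicUnit.real_rowMul_ge {n : ℕ} {ν : Measure (CVec (n + 1))}
    (hν : IsIsotropicUnit ν) {h : Fin (n + 1) → ℂ} (hh : 0 < ∑ i, ‖h i‖ ^ 2) {t : ℝ}
    (ht0 : 0 < t) (ht1 : t ≤ 1) :
    ν.real {w | (1 - t) * ∑ i, ‖h i‖ ^ 2 ≤ ‖rowMul h w‖ ^ 2} = t ^ n := by
  have := hν.isProbabilityMeasure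
  have hm : MeasurableSet {p : (Fin (n + 1) → ℂ) × CVec (n + 1) |
      (1 - t) * ∑ i, ‖p.1 i‖ ^ 2 ≤ ‖rowMul p.1 p.2‖ ^ 2} :=
    measurableSet_le (by fun_prop) (by fun_prop)
  have h1 := Measure.prod_apply (μ := stdGaussianVec (n + 1)) (ν := ν) hm
  -- Fubini with a Gaussian direction: for fixed `g` the `ν`-probability is independent of `g` by
  -- isotropy, while for fixed unit `w` the Gaussian probability is `t ^ n`. This needs no explicit
  -- description of `ν`.
  have h2 := Measure.prod_apply_symm (μ := stdGaussianVec (n + 1)) (ν := ν) hm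
  have h3 : ∫⁻ g, ν (Prod.mk g ⁻¹' {p : (Fin (n + 1) → ℂ) × CVec (n + 1) |
      (1 - t) * ∑ i, ‖p.1 i‖ ^ 2 ≤ ‖rowMul p.1 p.2‖ ^ 2}) ∂stdGaussianVec (n + 1)
      = ν {w | (1 - t) * ∑ i, ‖h i‖ ^ 2 ≤ ‖rowMul h w‖ ^ 2} := by
    refine (lintegral_congr_ae ((ae_stdGaussianVec_sum_pos n).mono fun g hg =>
      hν.measure_rowMul_ge_congr hg hh t)).trans ?_
    simp
  have h4 : ∫⁻ w, stdGaussianVec (n + 1) ((fun g => (g, w)) ⁻¹' {p : (Fin (n + 1) → ℂ) × CVec (n + 1) |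
      (1 - t) * ∑ i, ‖p.1 i‖ ^ 2 ≤ ‖rowMul p.1 p.2‖ ^ 2}) ∂ν = ENNReal.ofReal (t ^ n) := by
    rw [lintegral_congr_ae (g := fun _ => ENNReal.ofReal (t ^ n)) (hν.norm_eq_one.mono fun w hw => ?_)]
    · simp
    · rw [← stdGaussianVec_real_rowMul_ge hw ht0 ht1, ofReal_measureReal]
      rfl
  rw [measureReal_def, ← h3, ← h1, h2, h4, ENNReal.toReal_ofReal (by positivity)]

theorem norm_rowMul_sq_le {N : ℕ} (h : Fin N → ℂ) {w : CVec N} (hw : ‖w‖ = 1) :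
    ‖rowMul h w‖ ^ 2 ≤ ∑ i, ‖h i‖ ^ 2 := by
  rw [rowMul_eq_inner, ← norm_conjVec_sq]
  have := norm_inner_le_norm (𝕜 := ℂ) (conjVec h) w
  rw [hw, mul_one] at this
  gcongr

/-- The distribution function `t ^ n` is continuous, so the gain has no atoms. At `t = 0` this
requires `n ≥ 1`. -/
theorem IsIsotropicUnit.rowMul_eq_null {n : ℕ} (hn : 1 ≤ n) {ν : Measure (CVec (n + 1))}
    (hν : IsIsotropicUnit ν) {h : Fin (n + 1) → ℂ} (hh : 0 < ∑ i, ‖h i‖ ^ 2) (a : ℝ) :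
    ν {w | ‖rowMul h w‖ ^ 2 = a} = 0 := by
  have := hν.isProbabilityMeasure
  set c := ∑ i, ‖h i‖ ^ 2 with hc
  obtain ⟨t, rfl⟩ : ∃ t, a = (1 - t) * c := ⟨1 - a / c, by field_simp; ring⟩
  have hm : ∀ s, MeasurableSet {w : CVec (n + 1) | (1 - s) * c ≤ ‖rowMul h w‖ ^ 2} := fun s =>
    measurableSet_le (by fun_prop) (by fun_prop)
  rw [← measureReal_eq_zero_iff]
  rcases lt_trichotomy t 0 with ht | rfl | ht
  · rw [measureReal_eq_zero_iff]
    refine measure_mono_null (t := {w | ¬ ‖w‖ = 1}) ?_ hν.norm_eq_one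
    intro w hw hw1
    have := norm_rowMul_sq_le h hw1
    rw [Set.mem_ofPred_eq] at hw
    nlinarith
  · have hlim : Tendsto (fun s : ℝ => s ^ n) (𝓝[>] 0) (𝓝 0) := by
      have : Tendsto (fun s : ℝ => s ^ n) (𝓝 0) (𝓝 (0 ^ n)) := (continuous_pow n).tendsto 0
      rw [zero_pow (by omega)] at this
      exact this.mono_left nhdsWithin_le_nhds
    refine le_antisymm (ge_of_tendsto hlim ?_) measureReal_nonneg
    filter_upwards [Ioo_mem_nhdsGT (zero_lt_one (α := ℝ))] with s hs
    rw [← hν.real_rowMul_ge hh hs.1 hs.2.le]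
    refine measureReal_mono fun w hw => ?_
    rw [Set.mem_ofPred_eq] at hw ⊢
    rw [hw]
    nlinarith [hs.1]
  · rcases le_or_gt t 1 with ht1 | ht1
    · have hlim : Tendsto (fun s : ℝ => t ^ n - s ^ n) (𝓝[<] t) (𝓝 0) := by
        have : Tendsto (fun s : ℝ => t ^ n - s ^ n) (𝓝 t) (𝓝 (t ^ n - t ^ n)) :=
          Continuous.tendsto (by fun_prop) t
        rw [sub_self] at this
        exact this.mono_left nhdsWithin_le_nhds
      refine le_antisymm (ge_of_tendsto hlim ?_) measureReal_nonneg
      filter_upwards [Ioo_mem_nhdsLT ht] with s hs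
      rw [← hν.real_rowMul_ge hh hs.1 (hs.2.le.trans ht1), ← hν.real_rowMul_ge hh ht ht1,
        ← measureReal_sdiff _ (hm s)]
      · refine measureReal_mono fun w hw => ?_
        rw [Set.mem_ofPred_eq] at hw
        rw [Set.mem_sdiff, Set.mem_ofPred_eq, Set.mem_ofPred_eq, hw]
        exact ⟨le_rfl, fun h => by nlinarith [hs.2]⟩
      · intro w hw
        rw [Set.mem_ofPred_eq] at hw ⊢
        nlinarith [hs.2]
    · rw [show {w : CVec (n + 1) | ‖rowMul h w‖ ^ 2 = (1 - t) * c} = ∅ from ?_]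
      · simp
      · ext w
        simp only [Set.mem_ofPred_eq, Set.mem_empty_iff_false, iff_false]
        nlinarith [sq_nonneg ‖rowMul h w‖]

/-! ### Rates along a random beam -/

@[fun_prop]
theorem measurable_conjVec {N : ℕ} : Measurable (conjVec : (Fin N → ℂ) → CVec N) := by
  unfold conjVec
  exact (WithLp.measurable_toLp 2 _).comp (by fun_prop)

@[fun_prop]
theorem Measurable.beamRate {X : Type*} [MeasurableSpace X] (su sv s : ℝ) {T a : X → ℝ}
    (hT : Measurable T) (ha : Measurable a) :
    Measurable fun x => beamRate su sv s (T x) (a x) := by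
  unfold _root_.beamRate; fun_prop

theorem beamRate_nonneg {su sv s T a : ℝ} (hsu : 0 ≤ su) (hsv : 0 ≤ sv) (hs : 0 < s)
    (ha : 0 ≤ a) (haT : a ≤ T) : 0 ≤ beamRate su sv s T a := by
  have : 0 ≤ T - a := sub_nonneg.2 haT
  exact Real.log_nonneg (le_add_of_nonneg_right (by positivity))

/-- Drop the artificial noise from the denominator and use `log (1 + x) ≤ x`. -/
theorem beamRate_le {su sv s T a : ℝ} (hsu : 0 ≤ su) (hsv : 0 ≤ sv) (hs : 0 < s)
    (ha : 0 ≤ a) (haT : a ≤ T) : beamRate su sv s T a ≤ su / s * a := by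
  have h0 : 0 ≤ T - a := sub_nonneg.2 haT
  have h1 : 0 ≤ a * su / (sv * (T - a) + s) := by positivity
  have h2 : a * su / (sv * (T - a) + s) ≤ a * su / s := by
    gcongr
    exact le_add_of_nonneg_left (by positivity)
  have h3 := Real.log_le_sub_one_of_pos (x := 1 + a * su / (sv * (T - a) + s)) (by positivity)
  calc beamRate su sv s T a ≤ a * su / (sv * (T - a) + s) := by unfold beamRate; linarith
    _ ≤ su / s * a := h2.trans_eq (by ring)

theorem integrable_norm_sq_stdGaussianVec_eval {N : ℕ} (i : Fin N) :
    Integrable (fun g : Fin N → ℂ => ‖g i‖ ^ 2) (stdGaussianVec N) :=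
  integrable_comp_eval (μ := fun _ : Fin N => complexGaussian 1)
    (integrable_norm_sq_complexGaussian zero_le_one)

theorem integrable_sum_norm_sq_stdGaussianVec (N : ℕ) :
    Integrable (fun g : Fin N → ℂ => ∑ i, ‖g i‖ ^ 2) (stdGaussianVec N) :=
  integrable_finsetSum _ fun i _ => integrable_norm_sq_stdGaussianVec_eval i

theorem stdGaussianVec_map_rowMul {N : ℕ} (u : CVec N) :
    (stdGaussianVec N).map (fun g => rowMul g u) = complexGaussian (‖u‖ ^ 2) := by
  have := complexGaussian_map_sum_pi zero_le_one u.ofLp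
  rw [one_mul, ← EuclideanSpace.norm_sq_eq] at this
  rw [← this]
  congr 1
  ext g
  simp [rowMul, mul_comm]

section Beam

variable {Ω : Type*} [MeasurableSpace Ω] {μ : Measure Ω} {N : ℕ} {G : Ω → Fin N → ℂ}
  {U : Ω → CVec N}

theorem integrable_sum_norm_sq (hG : HasLaw G (stdGaussianVec N) μ) :
    Integrable (fun ω => ∑ i, ‖G ω i‖ ^ 2) μ := by
  have := integrable_sum_norm_sq_stdGaussianVec N
  rw [← hG.map_eq, integrable_map_measure
    (Measurable.aestronglyMeasurable (by fun_prop)) hG.aemeasurable] at this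
  exact this

theorem aemeasurable_beamRate (su sv s : ℝ) (hG : AEMeasurable G μ) (hU : AEMeasurable U μ) :
    AEMeasurable (fun ω => beamRate su sv s (∑ i, ‖G ω i‖ ^ 2) (‖rowMul (G ω) (U ω)‖ ^ 2)) μ := by
  have h1 : Measurable fun p : (Fin N → ℂ) × CVec N =>
      beamRate su sv s (∑ i, ‖p.1 i‖ ^ 2) (‖rowMul p.1 p.2‖ ^ 2) :=
    Measurable.beamRate su sv s (by fun_prop) (by fun_prop)
  exact h1.comp_aemeasurable (f := fun ω => (G ω, U ω)) (hG.prodMk hU)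

theorem integrable_beamRate {su sv s : ℝ} (hsu : 0 ≤ su) (hsv : 0 ≤ sv) (hs : 0 < s)
    (hG : HasLaw G (stdGaussianVec N) μ) (hU : AEMeasurable U μ) (hU1 : ∀ᵐ ω ∂μ, ‖U ω‖ = 1) :
    Integrable (fun ω => beamRate su sv s (∑ i, ‖G ω i‖ ^ 2) (‖rowMul (G ω) (U ω)‖ ^ 2)) μ := by
  refine ((integrable_sum_norm_sq hG).const_mul (su / s)).mono'
    (aemeasurable_beamRate su sv s hG.aemeasurable hU).aestronglyMeasurable ?_
  filter_upwards [hU1] with ω hω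
  have h1 := norm_rowMul_sq_le (G ω) hω
  rw [Real.norm_of_nonneg (beamRate_nonneg hsu hsv hs (by positivity) h1)]
  exact (beamRate_le hsu hsv hs (by positivity) h1).trans (by gcongr)

variable [IsProbabilityMeasure μ]

/-- Conditionally on the unit beam, the received coefficient is a standard complex Gaussian. -/
theorem integrable_norm_rowMul_sq_of_indepFun (hG : HasLaw G (stdGaussianVec N) μ)
    (hU : AEMeasurable U μ) (hU1 : ∀ᵐ ω ∂μ, ‖U ω‖ = 1) (hind : IndepFun U G μ) :
    Integrable (fun ω => ‖rowMul (G ω) (U ω)‖ ^ 2) μ ∧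
      ∫ ω, ‖rowMul (G ω) (U ω)‖ ^ 2 ∂μ = 1 := by
  have hmap := (indepFun_iff_map_prod_eq_prod_map_map hU hG.aemeasurable).1 hind
  rw [hG.map_eq] at hmap
  have := Measure.isProbabilityMeasure_map (μ := μ) hU
  have hU1' : ∀ᵐ u ∂μ.map U, ‖u‖ = 1 :=
    (ae_map_iff hU (measurableSet_eq_fun (by fun_prop) (by fun_prop))).2 hU1
  have hin : ∀ u : CVec N, Integrable (fun g => ‖rowMul g u‖ ^ 2) (stdGaussianVec N) ∧
      ∫ g, ‖rowMul g u‖ ^ 2 ∂stdGaussianVec N = ‖u‖ ^ 2 := by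
    intro u
    have hm : Measurable fun g : Fin N → ℂ => rowMul g u := by fun_prop
    have h1 := integrable_norm_sq_complexGaussian (v := ‖u‖ ^ 2) (by positivity)
    have h2 := integral_norm_sq_complexGaussian (v := ‖u‖ ^ 2) (by positivity)
    rw [← stdGaussianVec_map_rowMul] at h1 h2
    rw [integrable_map_measure (by fun_prop) hm.aemeasurable] at h1
    rw [integral_map hm.aemeasurable (by fun_prop)] at h2
    exact ⟨h1, h2⟩
  have hmeas : Measurable fun p : CVec N × (Fin N → ℂ) => ‖rowMul p.2 p.1‖ ^ 2 := by fun_prop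
  have hint : Integrable (fun p : CVec N × (Fin N → ℂ) => ‖rowMul p.2 p.1‖ ^ 2)
      ((μ.map U).prod (stdGaussianVec N)) := by
    rw [integrable_prod_iff hmeas.aestronglyMeasurable]
    refine ⟨ae_of_all _ fun u => (hin u).1, ?_⟩
    refine (integrable_const (1 : ℝ)).congr ?_
    filter_upwards [hU1'] with u hu
    simp [(hin u).2, hu]
  have hpair : AEMeasurable (fun ω => (U ω, G ω)) μ := hU.prodMk hG.aemeasurable
  constructor
  · rw [← hmap, integrable_map_measure hmeas.aestronglyMeasurable hpair] at hint
    exact hint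
  · have h1 : ∫ p, ‖rowMul p.2 p.1‖ ^ 2 ∂((μ.map U).prod (stdGaussianVec N)) = 1 := by
      rw [integral_prod _ hint]
      rw [integral_congr_ae (g := fun _ => (1 : ℝ))]
      · simp
      · filter_upwards [hU1'] with u hu
        simp [(hin u).2, hu]
    rw [← hmap, integral_map hpair hmeas.aestronglyMeasurable] at h1
    exact h1

theorem integral_beamRate_mem_Icc {su sv s : ℝ} (hsu : 0 ≤ su) (hsv : 0 ≤ sv) (hs : 0 < s)
    (hG : HasLaw G (stdGaussianVec N) μ) (hU : AEMeasurable U μ) (hU1 : ∀ᵐ ω ∂μ, ‖U ω‖ = 1)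
    (hind : IndepFun U G μ) :
    ∫ ω, beamRate su sv s (∑ i, ‖G ω i‖ ^ 2) (‖rowMul (G ω) (U ω)‖ ^ 2) ∂μ
      ∈ Set.Icc 0 (su / s) := by
  constructor
  · refine integral_nonneg_of_ae ?_
    filter_upwards [hU1] with ω hω
    exact beamRate_nonneg hsu hsv hs (by positivity) (norm_rowMul_sq_le (G ω) hω)
  · have h := integrable_norm_rowMul_sq_of_indepFun hG hU hU1 hind
    calc _ ≤ ∫ ω, su / s * ‖rowMul (G ω) (U ω)‖ ^ 2 ∂μ := by
          refine integral_mono_ae (integrable_beamRate hsu hsv hs hG hU hU1)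
            (h.1.const_mul _) ?_
          filter_upwards [hU1] with ω hω
          exact beamRate_le hsu hsv hs (by positivity) (norm_rowMul_sq_le (G ω) hω)
      _ = su / s := by rw [integral_const_mul, h.2, mul_one]

end Beam

/-! ### The random vector quantization system -/

theorem chordalDist_mem_Icc {N : ℕ} {a b : CVec N} (ha : ‖a‖ = 1) (hb : ‖b‖ = 1) :
    chordalDist a b ∈ Set.Icc 0 1 := by
  have := norm_inner_le_norm (𝕜 := ℂ) a b
  rw [ha, hb, one_mul] at this
  constructor
  · exact sub_nonneg.2 (pow_le_one₀ (norm_nonneg _) this)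
  · exact sub_le_self _ (by positivity)

/-- If the last columns of `V` lie in the null space of `h`, then `h` is aligned with the first
column. -/
theorem conjVec_eq_smul_of_null {n : ℕ} {h : Fin (n + 1) → ℂ} {V : Precoder (n + 1)}
    (hV : ∀ i : Fin n, rowMul h (V i.succ) = 0) :
    conjVec h = star (rowMul h (V 0)) • V 0 := by
  conv_lhs => rw [← V.sum_repr' (conjVec h)]
  have : ∀ i, inner ℂ (V i) (conjVec h) = star (rowMul h (V i)) := fun i => by
    rw [rowMul_eq_inner]; exact (inner_conj_symm _ _).symm
  simp_rw [this]
  rw [Fin.sum_univ_succ]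
  simp [hV]

theorem norm_rowMul_zero_sq_of_null {n : ℕ} {h : Fin (n + 1) → ℂ} {V : Precoder (n + 1)}
    (hV : ∀ i : Fin n, rowMul h (V i.succ) = 0) : ‖rowMul h (V 0)‖ ^ 2 = ∑ i, ‖h i‖ ^ 2 := by
  rw [← sum_norm_rowMul_sq h V, Fin.sum_univ_succ]
  simp [hV]

theorem norm_rowMul_sq_of_null {n : ℕ} {h : Fin (n + 1) → ℂ} {V : Precoder (n + 1)}
    (hV : ∀ i : Fin n, rowMul h (V i.succ) = 0) (w : CVec (n + 1)) :
    ‖rowMul h w‖ ^ 2 = (∑ i, ‖h i‖ ^ 2) * (1 - chordalDist w (V 0)) := by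
  rw [rowMul_eq_inner, conjVec_eq_smul_of_null hV, inner_smul_left, norm_mul, mul_pow,
    ← norm_rowMul_zero_sq_of_null hV, chordalDist, sub_sub_cancel, norm_inner_symm]
  simp

namespace IsRVQSystem

variable {Ω : Type*} [MeasurableSpace Ω] {μ : Measure Ω} {n B : ℕ}
  {H G : Ω → Fin (n + 1) → ℂ} {V : Ω → Precoder (n + 1)}
  {W : Fin (2 ^ B) → Ω → CVec (n + 1)} {j : Ω → Fin (2 ^ B)}

theorem aemeasurable_codebook (hs : IsRVQSystem μ H G V W j) :
    AEMeasurable (fun ω i => W i ω) μ := aemeasurable_pi_lambda _ hs.aemeasurable_W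

theorem indepFun_H_codebook (hs : IsRVQSystem μ H G V W j) :
    IndepFun H (fun ω i => W i ω) μ :=
  hs.indep_HG_W.comp measurable_fst measurable_id

theorem ae_norm_codeword (hs : IsRVQSystem μ H G V W j) : ∀ᵐ ω ∂μ, ∀ i, ‖W i ω‖ = 1 :=
  ae_all_iff.2 fun i => ae_of_ae_map (hs.aemeasurable_W i) (hs.law_W i).norm_eq_one

theorem ae_norm_selected (hs : IsRVQSystem μ H G V W j) : ∀ᵐ ω ∂μ, ‖W (j ω) ω‖ = 1 :=
  hs.ae_norm_codeword.mono fun ω h => h (j ω)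

theorem ae_gain_pos (hs : IsRVQSystem μ H G V W j) : ∀ᵐ ω ∂μ, 0 < ∑ i, ‖H ω i‖ ^ 2 :=
  have hm : MeasurableSet {h : Fin (n + 1) → ℂ | 0 < ∑ i, ‖h i‖ ^ 2} :=
    measurableSet_lt (by fun_prop) (by fun_prop)
  (hs.law_H.ae_iff hm.mem).2 (ae_stdGaussianVec_sum_pos n)

/-- Distances lie in `[0, 1]`, so minimizing their squares minimizes them, which amounts to
maximizing the gain since `h` is aligned with `V 0`. From here on the selection rule no longer
involves `V`. -/
theorem ae_selected_gain_ge (hs : IsRVQSystem μ H G V W j) :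
    ∀ᵐ ω ∂μ, ∀ i, ‖rowMul (H ω) (W i ω)‖ ^ 2 ≤ ‖rowMul (H ω) (W (j ω) ω)‖ ^ 2 := by
  filter_upwards [hs.null_space, hs.selection, hs.ae_norm_codeword] with ω h1 h2 h3 i
  have hd := chordalDist_mem_Icc (h3 i) ((V ω).norm_eq_one 0)
  have hdj := chordalDist_mem_Icc (h3 (j ω)) ((V ω).norm_eq_one 0)
  have := (sq_le_sq₀ hdj.1 hd.1).1 (h2 i)
  rw [norm_rowMul_sq_of_null h1, norm_rowMul_sq_of_null h1]
  gcongr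

variable [IsProbabilityMeasure μ]

theorem map_H_codebook (hs : IsRVQSystem μ H G V W j) :
    μ.map (fun ω => (H ω, fun i => W i ω))
      = (stdGaussianVec (n + 1)).prod (Measure.pi fun i => μ.map (W i)) := by
  rw [(indepFun_iff_map_prod_eq_prod_map_map hs.law_H.aemeasurable hs.aemeasurable_codebook).1
    hs.indepFun_H_codebook, hs.law_H.map_eq,
    (iIndepFun_iff_map_fun_eq_pi_map hs.aemeasurable_W).1 hs.indep_W]

theorem map_H_codeword (hs : IsRVQSystem μ H G V W j) (i : Fin (2 ^ B)) :
    μ.map (fun ω => (H ω, W i ω)) = (stdGaussianVec (n + 1)).prod (μ.map (W i)) := by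
  rw [(indepFun_iff_map_prod_eq_prod_map_map hs.law_H.aemeasurable (hs.aemeasurable_W i)).1
    (hs.indepFun_H_codebook.comp measurable_id (measurable_pi_apply i)), hs.law_H.map_eq]

theorem map_H_codeword_pair (hs : IsRVQSystem μ H G V W j) {i k : Fin (2 ^ B)} (hik : i ≠ k) :
    μ.map (fun ω => (H ω, (W i ω, W k ω)))
      = (stdGaussianVec (n + 1)).prod ((μ.map (W i)).prod (μ.map (W k))) := by
  have h1 : IndepFun H (fun ω => (W i ω, W k ω)) μ :=
    hs.indepFun_H_codebook.comp (ψ := fun w : Fin (2 ^ B) → CVec (n + 1) => (w i, w k))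
      measurable_id (by fun_prop)
  rw [(indepFun_iff_map_prod_eq_prod_map_map hs.law_H.aemeasurable
    ((hs.aemeasurable_W i).prodMk (hs.aemeasurable_W k))).1 h1, hs.law_H.map_eq,
    (indepFun_iff_map_prod_eq_prod_map_map (hs.aemeasurable_W i) (hs.aemeasurable_W k)).1
      (hs.indep_W.indepFun hik)]

/-- The joint law of `H`, `G` and the codebook is a product, so its factors may be regrouped. -/
theorem indepFun_H_codebook_G (hs : IsRVQSystem μ H G V W j) :
    IndepFun (fun ω => (H ω, fun i => W i ω)) G μ := by
  have hW := hs.aemeasurable_codebook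
  have hpw := Measure.isProbabilityMeasure_map (μ := μ) hW
  have hpi : ∀ i, IsProbabilityMeasure (μ.map (W i)) := fun i =>
    Measure.isProbabilityMeasure_map (hs.aemeasurable_W i)
  have hH := hs.law_H.aemeasurable
  have hG := hs.law_G.aemeasurable
  rw [indepFun_iff_map_prod_eq_prod_map_map (hH.prodMk hW) hG, hs.map_H_codebook,
    hs.law_G.map_eq]
  have h1 := (indepFun_iff_map_prod_eq_prod_map_map (hH.prodMk hG) hW).1 hs.indep_HG_W
  rw [(indepFun_iff_map_prod_eq_prod_map_map hH hG).1 hs.indep_HG, hs.law_H.map_eq,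
    hs.law_G.map_eq, (iIndepFun_iff_map_fun_eq_pi_map hs.aemeasurable_W).1 hs.indep_W] at h1
  set γ := stdGaussianVec (n + 1)
  set π := Measure.pi fun i => μ.map (W i)
  have hmp : MeasurePreserving (fun p : ((Fin (n + 1) → ℂ) × (Fin (n + 1) → ℂ)) ×
      (Fin (2 ^ B) → CVec (n + 1)) => ((p.1.1, p.2), p.1.2)) ((γ.prod γ).prod π)
      ((γ.prod π).prod γ) :=
    ((measurePreserving_prodAssoc γ π γ).symm _).comp
      (((MeasurePreserving.id γ).prod Measure.measurePreserving_swap).comp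
        (measurePreserving_prodAssoc γ γ π))
  rw [← hmp.map_eq, ← h1, AEMeasurable.map_map_of_aemeasurable hmp.measurable.aemeasurable
    ((hH.prodMk hG).prodMk hW)]
  rfl

/-- Given the channel and one codeword, the gain of another, independent codeword has no atoms, so
it almost surely avoids the first gain. -/
theorem ae_codeword_gain_ne (hs : IsRVQSystem μ H G V W j) (hn : 1 ≤ n) :
    ∀ᵐ ω ∂μ, ∀ i k, i ≠ k → ‖rowMul (H ω) (W i ω)‖ ^ 2 ≠ ‖rowMul (H ω) (W k ω)‖ ^ 2 := by
  rw [ae_all_iff]; intro i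
  rw [ae_all_iff]; intro k
  by_cases hik : i = k
  · simp [hik]
  have hpi : ∀ i, IsProbabilityMeasure (μ.map (W i)) := fun i =>
    Measure.isProbabilityMeasure_map (hs.aemeasurable_W i)
  have hm : MeasurableSet {p : (Fin (n + 1) → ℂ) × (CVec (n + 1) × CVec (n + 1)) |
      ‖rowMul p.1 p.2.1‖ ^ 2 = ‖rowMul p.1 p.2.2‖ ^ 2} :=
    measurableSet_eq_fun (by fun_prop) (by fun_prop)
  have h0 : ∀ᵐ p ∂μ.map (fun ω => (H ω, (W i ω, W k ω))),
      ¬ ‖rowMul p.1 p.2.1‖ ^ 2 = ‖rowMul p.1 p.2.2‖ ^ 2 := by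
    rw [hs.map_H_codeword_pair hik, ae_iff]
    simp only [not_not]
    rw [Measure.measure_prod_null hm]
    filter_upwards [ae_stdGaussianVec_sum_pos n] with h hh
    rw [Pi.zero_apply, Measure.measure_prod_null (hm.preimage measurable_prodMk_left)]
    refine ae_of_all _ fun a => ?_
    refine (congrArg _ ?_).trans ((hs.law_W k).rowMul_eq_null hn hh (‖rowMul h a‖ ^ 2))
    ext b
    exact eq_comm
  exact (ae_of_ae_map (hs.law_H.aemeasurable.prodMk
    ((hs.aemeasurable_W i).prodMk (hs.aemeasurable_W k))) h0).mono fun ω hω _ => hω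

end IsRVQSystem

/-- The codeword with the strictly largest gain along the channel (zero if there is a tie). -/
def bestCodeword {N M : ℕ} (p : (Fin N → ℂ) × (Fin M → CVec N)) : CVec N :=
  ∑ i, Set.indicator {p : (Fin N → ℂ) × (Fin M → CVec N) |
    ∀ k, k ≠ i → ‖rowMul p.1 (p.2 k)‖ ^ 2 < ‖rowMul p.1 (p.2 i)‖ ^ 2} (fun p => p.2 i) p

theorem measurable_bestCodeword {N M : ℕ} :
    Measurable (bestCodeword : (Fin N → ℂ) × (Fin M → CVec N) → CVec N) := by
  refine Finset.measurable_fun_sum _ fun i _ => Measurable.indicator (by fun_prop) ?_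
  simp only [Set.ofPred_forall]
  refine MeasurableSet.iInter fun k => MeasurableSet.iInter fun _ => ?_
  exact measurableSet_lt (by fun_prop) (by fun_prop)

namespace IsRVQSystem

variable {Ω : Type*} [MeasurableSpace Ω] {μ : Measure Ω} [IsProbabilityMeasure μ] {n B : ℕ}
  {H G : Ω → Fin (n + 1) → ℂ} {V : Ω → Precoder (n + 1)}
  {W : Fin (2 ^ B) → Ω → CVec (n + 1)} {j : Ω → Fin (2 ^ B)}

/-- This supplies both the measurability of the selected codeword and its independence of `G`,
neither of which is assumed for the index `j`. -/
theorem ae_selected_eq_bestCodeword (hs : IsRVQSystem μ H G V W j) (hn : 1 ≤ n) :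
    (fun ω => W (j ω) ω) =ᵐ[μ] fun ω => bestCodeword (H ω, fun i => W i ω) := by
  filter_upwards [hs.ae_selected_gain_ge, hs.ae_codeword_gain_ne hn] with ω h1 h2
  rw [bestCodeword, Finset.sum_eq_single (j ω)]
  · rw [Set.indicator_of_mem]
    exact fun k hk => (h1 k).lt_of_ne (h2 k (j ω) hk)
  · intro i _ hi
    rw [Set.indicator_of_notMem]
    exact fun h => (h (j ω) hi.symm).not_ge (h1 i)
  · simp

theorem aemeasurable_selected (hs : IsRVQSystem μ H G V W j) (hn : 1 ≤ n) :
    AEMeasurable (fun ω => W (j ω) ω) μ :=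
  (measurable_bestCodeword.comp_aemeasurable
    (hs.law_H.aemeasurable.prodMk hs.aemeasurable_codebook)).congr
    (hs.ae_selected_eq_bestCodeword hn).symm

theorem indepFun_selected_G (hs : IsRVQSystem μ H G V W j) (hn : 1 ≤ n) :
    IndepFun (fun ω => W (j ω) ω) G μ :=
  (hs.indepFun_H_codebook_G.comp measurable_bestCodeword measurable_id).congr
    (hs.ae_selected_eq_bestCodeword hn).symm (ae_eq_refl _)

end IsRVQSystem

/-- The unit vector along the (conjugated) channel `h`. -/
def matchedBeam {N : ℕ} (h : Fin N → ℂ) : CVec N := (‖conjVec h‖⁻¹ : ℂ) • conjVec h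

@[fun_prop]
theorem measurable_matchedBeam {N : ℕ} : Measurable (matchedBeam : (Fin N → ℂ) → CVec N) := by
  unfold matchedBeam; fun_prop

theorem norm_matchedBeam {N : ℕ} {h : Fin N → ℂ} (hh : 0 < ∑ i, ‖h i‖ ^ 2) :
    ‖matchedBeam h‖ = 1 := by
  rw [← norm_conjVec_sq] at hh
  have : ‖conjVec h‖ ≠ 0 := fun h0 => by simp [h0] at hh
  rw [matchedBeam, norm_smul]
  simp [this]

/-- The two beams differ by a phase. This replaces `V 0`, for which measurability is not assumed, by
a measurable function of the channel. -/
theorem norm_rowMul_matchedBeam {n : ℕ} {h : Fin (n + 1) → ℂ} {V : Precoder (n + 1)}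
    (hh : 0 < ∑ i, ‖h i‖ ^ 2) (hV : ∀ i : Fin n, rowMul h (V i.succ) = 0)
    (g : Fin (n + 1) → ℂ) : ‖rowMul g (matchedBeam h)‖ = ‖rowMul g (V 0)‖ := by
  have h1 := norm_rowMul_zero_sq_of_null hV
  rw [← norm_conjVec_sq, sq_eq_sq₀ (norm_nonneg _) (norm_nonneg _)] at h1
  rw [← norm_conjVec_sq] at hh
  have h2 : ‖conjVec h‖ ≠ 0 := fun h0 => by simp [h0] at hh
  rw [matchedBeam, rowMul_smul]
  conv_lhs => rw [conjVec_eq_smul_of_null hV]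
  rw [rowMul_smul, ← conjVec_eq_smul_of_null hV]
  simp [h1]
  field_simp

/-! ### Concentration of the channel gain -/

theorem memLp_norm_sq_complexGaussian_one :
    MemLp (fun z : ℂ => ‖z‖ ^ 2) 2 (complexGaussian 1) := by
  rw [memLp_two_iff_integrable_sq (by fun_prop)]
  refine integrable_norm_pow_four_complexGaussian_one.congr (ae_of_all _ fun z => ?_)
  ring

theorem variance_norm_sq_complexGaussian_one :
    Var[fun z : ℂ => ‖z‖ ^ 2; complexGaussian 1] = 1 := by
  rw [variance_eq_sub memLp_norm_sq_complexGaussian_one, integral_norm_sq_complexGaussian_one]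
  have : ∀ z : ℂ, ((fun z : ℂ => ‖z‖ ^ 2) ^ 2) z = ‖z‖ ^ 4 := fun z => by
    simp only [Pi.pow_apply]; ring
  simp_rw [this, integral_norm_pow_four_complexGaussian_one]
  norm_num

theorem integral_sum_norm_sq_stdGaussianVec (N : ℕ) :
    ∫ g, ∑ i, ‖g i‖ ^ 2 ∂stdGaussianVec N = N := by
  rw [integral_finsetSum _ fun i _ => integrable_norm_sq_stdGaussianVec_eval i]
  have : ∀ i : Fin N, ∫ g, ‖g i‖ ^ 2 ∂stdGaussianVec N = 1 := fun i => by
    rw [integral_comp_eval (μ := fun _ : Fin N => complexGaussian 1) (f := fun z : ℂ => ‖z‖ ^ 2)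
      (by fun_prop), integral_norm_sq_complexGaussian_one]
  simp [this]

theorem integral_sum_norm_sq_sub_sq_stdGaussianVec (N : ℕ) :
    Integrable (fun g : Fin N → ℂ => (∑ i, ‖g i‖ ^ 2 - N) ^ 2) (stdGaussianVec N) ∧
    ∫ g, (∑ i, ‖g i‖ ^ 2 - N) ^ 2 ∂stdGaussianVec N = N := by
  have hm : ∀ i : Fin N, MemLp (fun g : Fin N → ℂ => ‖g i‖ ^ 2) 2 (stdGaussianVec N) := fun i =>
    memLp_norm_sq_complexGaussian_one.comp_measurePreserving
      (measurePreserving_eval (fun _ : Fin N => complexGaussian 1) i)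
  have hsum : MemLp (fun g : Fin N → ℂ => ∑ i, ‖g i‖ ^ 2) 2 (stdGaussianVec N) :=
    memLp_finsetSum _ fun i _ => hm i
  have hv := variance_sum_pi (μ := fun _ : Fin N => complexGaussian 1)
    (X := fun _ z => ‖z‖ ^ 2) (fun _ => memLp_norm_sq_complexGaussian_one)
  simp only [variance_norm_sq_complexGaussian_one, Finset.sum_const, Finset.card_univ,
    Fintype.card_fin, nsmul_eq_mul, mul_one] at hv
  have he : (∑ i : Fin N, fun g : Fin N → ℂ => ‖g i‖ ^ 2) = fun g => ∑ i, ‖g i‖ ^ 2 := by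
    ext g; simp
  rw [he, variance_eq_integral hsum.aestronglyMeasurable.aemeasurable,
    integral_sum_norm_sq_stdGaussianVec] at hv
  exact ⟨(hsum.sub (memLp_const _)).integrable_sq, hv⟩

section Gain

variable {Ω : Type*} [MeasurableSpace Ω] {μ : Measure Ω} [IsProbabilityMeasure μ] {N : ℕ}
  {G : Ω → Fin N → ℂ}

/-- Since the variance is `N`, this follows from `y ≤ y² / (2 √N) + √N / 2`. -/
theorem integral_abs_sum_norm_sq_sub_le (hN : 0 < N) (hG : HasLaw G (stdGaussianVec N) μ) :
    ∫ ω, |∑ i, ‖G ω i‖ ^ 2 - N| ∂μ ≤ √N := by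
  have hN' : 0 < √(N : ℝ) := by positivity
  obtain ⟨h1, h2⟩ := integral_sum_norm_sq_sub_sq_stdGaussianVec N
  rw [← hG.map_eq] at h1 h2
  rw [integrable_map_measure (Measurable.aestronglyMeasurable (by fun_prop)) hG.aemeasurable,
    Function.comp_def] at h1
  rw [integral_map hG.aemeasurable (Measurable.aestronglyMeasurable (by fun_prop))] at h2
  calc ∫ ω, |∑ i, ‖G ω i‖ ^ 2 - N| ∂μ
      ≤ ∫ ω, ((∑ i, ‖G ω i‖ ^ 2 - N) ^ 2 / (2 * √N) + √N / 2) ∂μ := by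
        refine integral_mono (((integrable_sum_norm_sq hG).sub (integrable_const _)).abs)
          ((h1.div_const (2 * √N)).add (integrable_const (√N / 2))) fun ω => ?_
        rw [← sq_abs]
        set y := |∑ i, ‖G ω i‖ ^ 2 - (N : ℝ)|
        simp only
        rw [← sub_nonneg]
        have : y ^ 2 / (2 * √N) + √N / 2 - y = (y - √N) ^ 2 / (2 * √N) := by
          field_simp; ring
        rw [this]
        positivity
    _ = √N := by
        rw [integral_add (h1.div_const (2 * √N)) (integrable_const (√N / 2)), integral_div, h2]
        simp only [integral_const, probReal_univ, smul_eq_mul, one_mul]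
        have : (N : ℝ) = √N * √N := (Real.mul_self_sqrt (by positivity)).symm
        nth_rewrite 1 [this]
        field_simp
        ring

theorem integral_abs_mul_gain_sub_le (hN : 0 < N) (hG : HasLaw G (stdGaussianVec N) μ) {a : ℝ}
    (ha : 0 ≤ a) (x : ℝ) :
    ∫ ω, |a * ∑ i, ‖G ω i‖ ^ 2 - x| ∂μ ≤ a * √N + |a * N - x| := by
  have hi : Integrable (fun ω => |∑ i, ‖G ω i‖ ^ 2 - (N : ℝ)|) μ :=
    ((integrable_sum_norm_sq hG).sub (integrable_const _)).abs
  calc ∫ ω, |a * ∑ i, ‖G ω i‖ ^ 2 - x| ∂μ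
      ≤ ∫ ω, (a * |∑ i, ‖G ω i‖ ^ 2 - (N : ℝ)| + |a * N - x|) ∂μ := by
        refine integral_mono ((((integrable_sum_norm_sq hG).const_mul a).sub
          (integrable_const _)).abs) ((hi.const_mul a).add (integrable_const _)) fun ω => ?_
        have := abs_add_le (a * (∑ i, ‖G ω i‖ ^ 2 - (N : ℝ))) (a * N - x)
        rw [abs_mul, abs_of_nonneg ha] at this
        refine le_trans (le_of_eq ?_) this
        congr 1
        ring
    _ ≤ a * √N + |a * N - x| := by
        rw [integral_add (hi.const_mul a) (integrable_const _), integral_const_mul]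
        simp only [integral_const, probReal_univ, smul_eq_mul, one_mul]
        gcongr
        exact integral_abs_sum_norm_sq_sub_le hN hG

end Gain

/-! ### Lipschitz estimates for the rate -/

theorem abs_log_one_add_sub_le {a b : ℝ} (ha : 0 ≤ a) (hb : 0 ≤ b) :
    |Real.log (1 + a) - Real.log (1 + b)| ≤ |a - b| := by
  have key : ∀ a b : ℝ, 0 ≤ a → 0 ≤ b → Real.log (1 + a) - Real.log (1 + b) ≤ |a - b| := by
    intro a b ha hb
    rw [← Real.log_div (by positivity) (by positivity)]
    calc Real.log ((1 + a) / (1 + b)) ≤ (1 + a) / (1 + b) - 1 :=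
          Real.log_le_sub_one_of_pos (by positivity)
      _ = (a - b) / (1 + b) := by field_simp; ring
      _ ≤ |a - b| / (1 + b) := by gcongr; exact le_abs_self _
      _ ≤ |a - b| := div_le_self (abs_nonneg _) (by linarith)
  exact abs_le'.2 ⟨key a b ha hb, by rw [neg_sub, abs_sub_comm]; exact key b a hb ha⟩

/-- Clearing the denominator leaves two logarithms with arguments bilinear in the scaled gain and
the error, ready for the Lipschitz bound. -/
theorem beamRate_eq_log_sub_log {su β T d : ℝ} (hsu : 0 ≤ su) (hβ : 0 ≤ β) (hT : 0 ≤ T)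
    (hd0 : 0 ≤ d) (hd1 : d ≤ 1) : beamRate su (β * su) 1 T (T * (1 - d))
      = Real.log (1 + su * T * (β * d + (1 - d))) - Real.log (1 + su * T * (β * d)) := by
  have h1 : 0 ≤ 1 - d := by linarith
  rw [← Real.log_div (by positivity) (by positivity), beamRate]
  congr 1
  have h2 : 0 < 1 + su * T * (β * d) := by positivity
  rw [show β * su * (T - T * (1 - d)) + 1 = 1 + su * T * (β * d) by ring, eq_div_iff h2.ne',
    add_mul, div_mul_cancel₀ _ h2.ne']
  ring

theorem abs_beamRate_sub_le {su β T d D x : ℝ} (hsu : 0 ≤ su) (hβ : 0 ≤ β) (hT : 0 ≤ T)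
    (hd0 : 0 ≤ d) (hd1 : d ≤ 1) (hD0 : 0 ≤ D) (hD1 : D ≤ 1) (hx : 0 ≤ x) :
    |beamRate su (β * su) 1 T (T * (1 - d))
      - (Real.log (1 + x * (β * D + (1 - D))) - Real.log (1 + x * (β * D)))|
      ≤ (2 * β + 1) * |su * T - x| + x * (2 * β + 1) * |d - D| := by
  have h1 : 0 ≤ 1 - d := by linarith
  have h2 : 0 ≤ 1 - D := by linarith
  rw [beamRate_eq_log_sub_log hsu hβ hT hd0 hd1]
  set X := su * T with hX
  have hX0 : 0 ≤ X := by positivity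
  have e1 := abs_log_one_add_sub_le (a := X * (β * d + (1 - d))) (b := x * (β * D + (1 - D)))
    (by positivity) (by positivity)
  have e2 := abs_log_one_add_sub_le (a := X * (β * d)) (b := x * (β * D))
    (by positivity) (by positivity)
  -- The coefficients `β d + (1 - d)` and `|β - 1|` are both at most `β + 1`; together with the `β`
  -- from `b2` this yields `2 β + 1`.
  have b1 : |X * (β * d + (1 - d)) - x * (β * D + (1 - D))|
      ≤ (β + 1) * |X - x| + x * (β + 1) * |d - D| := by
    rw [show X * (β * d + (1 - d)) - x * (β * D + (1 - D))
      = (β * d + (1 - d)) * (X - x) + x * (β - 1) * (d - D) by ring]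
    refine (abs_add_le _ _).trans ?_
    rw [abs_mul, abs_mul, abs_mul, abs_of_nonneg hx,
      abs_of_nonneg (show 0 ≤ β * d + (1 - d) by positivity)]
    gcongr
    · nlinarith
    · linarith
    · exact abs_le.2 ⟨by linarith, by linarith⟩
  have b2 : |X * (β * d) - x * (β * D)| ≤ β * |X - x| + x * β * |d - D| := by
    rw [show X * (β * d) - x * (β * D) = (β * d) * (X - x) + x * β * (d - D) by ring]
    refine (abs_add_le _ _).trans ?_
    rw [abs_mul, abs_mul _ (d - D), abs_of_nonneg (show 0 ≤ x * β by positivity),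
      abs_of_nonneg (show 0 ≤ β * d by positivity)]
    gcongr
    nlinarith
  calc _ = |(Real.log (1 + X * (β * d + (1 - d))) - Real.log (1 + x * (β * D + (1 - D))))
        - (Real.log (1 + X * (β * d)) - Real.log (1 + x * (β * D)))| := by congr 1; ring
    _ ≤ _ := (abs_sub _ _).trans (by linarith)

/-! ### The quantization error -/

/-- The chordal distance between Bob's channel direction and the selected codeword. -/
def quantizationError {Ω : Type*} {N M : ℕ} (H : Ω → Fin N → ℂ) (W : Fin M → Ω → CVec N)
    (j : Ω → Fin M) (ω : Ω) : ℝ := 1 - ‖rowMul (H ω) (W (j ω) ω)‖ ^ 2 / ∑ i, ‖H ω i‖ ^ 2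

namespace IsRVQSystem

variable {Ω : Type*} [MeasurableSpace Ω] {μ : Measure Ω} {n B : ℕ}
  {H G : Ω → Fin (n + 1) → ℂ} {V : Ω → Precoder (n + 1)}
  {W : Fin (2 ^ B) → Ω → CVec (n + 1)} {j : Ω → Fin (2 ^ B)}

theorem ae_quantizationError_mem_Icc (hs : IsRVQSystem μ H G V W j) :
    ∀ᵐ ω ∂μ, quantizationError H W j ω ∈ Set.Icc 0 1 := by
  filter_upwards [hs.ae_gain_pos, hs.ae_norm_selected] with ω h1 h2
  exact ⟨sub_nonneg.2 ((div_le_one h1).2 (norm_rowMul_sq_le _ h2)),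
    sub_le_self _ (by positivity)⟩

theorem ae_selected_gain_eq (hs : IsRVQSystem μ H G V W j) :
    ∀ᵐ ω ∂μ, ‖rowMul (H ω) (W (j ω) ω)‖ ^ 2
      = (∑ i, ‖H ω i‖ ^ 2) * (1 - quantizationError H W j ω) := by
  filter_upwards [hs.ae_gain_pos] with ω h1
  rw [quantizationError, sub_sub_cancel, mul_div_cancel₀ _ h1.ne']

variable [IsProbabilityMeasure μ]

theorem aemeasurable_quantizationError (hs : IsRVQSystem μ H G V W j) (hn : 1 ≤ n) :
    AEMeasurable (quantizationError H W j) μ := by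
  have h1 : Measurable fun p : (Fin (n + 1) → ℂ) × CVec (n + 1) =>
      1 - ‖rowMul p.1 p.2‖ ^ 2 / ∑ i, ‖p.1 i‖ ^ 2 := by fun_prop
  exact h1.comp_aemeasurable (f := fun ω => (H ω, W (j ω) ω))
    (hs.law_H.aemeasurable.prodMk (hs.aemeasurable_selected hn))

theorem integrable_quantizationError (hs : IsRVQSystem μ H G V W j) (hn : 1 ≤ n) :
    Integrable (quantizationError H W j) μ := by
  refine (integrable_const (1 : ℝ)).mono' (hs.aemeasurable_quantizationError hn).aestronglyMeasurable ?_
  filter_upwards [hs.ae_quantizationError_mem_Icc] with ω hω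
  rw [Real.norm_of_nonneg hω.1]
  exact hω.2

theorem real_codeword_gain_ge (hs : IsRVQSystem μ H G V W j) (i : Fin (2 ^ B)) {t : ℝ}
    (ht0 : 0 < t) (ht1 : t ≤ 1) :
    μ.real {ω | (1 - t) * ∑ k, ‖H ω k‖ ^ 2 ≤ ‖rowMul (H ω) (W i ω)‖ ^ 2} = t ^ n := by
  have := Measure.isProbabilityMeasure_map (μ := μ) (hs.aemeasurable_W i)
  have hm : MeasurableSet {p : (Fin (n + 1) → ℂ) × CVec (n + 1) |
      (1 - t) * ∑ k, ‖p.1 k‖ ^ 2 ≤ ‖rowMul p.1 p.2‖ ^ 2} :=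
    measurableSet_le (by fun_prop) (by fun_prop)
  have h1 := Measure.map_apply_of_aemeasurable
    (hs.law_H.aemeasurable.prodMk (hs.aemeasurable_W i)) hm
  rw [hs.map_H_codeword i, Measure.prod_apply hm] at h1
  have h2 : (∫⁻ h, μ.map (W i) (Prod.mk h ⁻¹' {p : (Fin (n + 1) → ℂ) × CVec (n + 1) |
      (1 - t) * ∑ k, ‖p.1 k‖ ^ 2 ≤ ‖rowMul p.1 p.2‖ ^ 2}) ∂stdGaussianVec (n + 1))
      = ENNReal.ofReal (t ^ n) := by
    refine (lintegral_congr_ae (g := fun _ => ENNReal.ofReal (t ^ n)) ?_).trans (by simp)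
    filter_upwards [ae_stdGaussianVec_sum_pos n] with h hh
    rw [← (hs.law_W i).real_rowMul_ge hh ht0 ht1, ofReal_measureReal]
    rfl
  rw [h2] at h1
  rw [measureReal_def]
  refine (congrArg ENNReal.toReal h1.symm).trans (ENNReal.toReal_ofReal (by positivity))

/-- Union bound over the `2 ^ B` codewords. -/
theorem real_quantizationError_le (hs : IsRVQSystem μ H G V W j) {t : ℝ}
    (ht0 : 0 < t) (ht1 : t ≤ 1) :
    μ.real {ω | quantizationError H W j ω ≤ t} ≤ 2 ^ B * t ^ n := by
  have h1 : {ω | quantizationError H W j ω ≤ t} ≤ᵐ[μ]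
      ⋃ i, {ω | (1 - t) * ∑ k, ‖H ω k‖ ^ 2 ≤ ‖rowMul (H ω) (W i ω)‖ ^ 2} := by
    filter_upwards [hs.ae_selected_gain_eq] with ω h2
    intro h3
    refine Set.mem_iUnion.2 ⟨j ω, ?_⟩
    replace h3 : quantizationError H W j ω ≤ t := h3
    rw [Set.mem_ofPred_eq, h2, mul_comm]
    gcongr
  calc μ.real {ω | quantizationError H W j ω ≤ t}
      ≤ μ.real (⋃ i, {ω | (1 - t) * ∑ k, ‖H ω k‖ ^ 2 ≤ ‖rowMul (H ω) (W i ω)‖ ^ 2}) :=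
        ENNReal.toReal_mono (measure_ne_top _ _) (measure_mono_ae h1)
    _ ≤ ∑ i, μ.real {ω | (1 - t) * ∑ k, ‖H ω k‖ ^ 2 ≤ ‖rowMul (H ω) (W i ω)‖ ^ 2} :=
        measureReal_iUnion_fintype_le _
    _ = 2 ^ B * t ^ n := by simp [hs.real_codeword_gain_ge _ ht0 ht1]

/-- A large error means every codeword is far from the channel direction. Given the channel these
events are independent, with joint probability `(1 - t ^ n) ^ 2 ^ B`. -/
theorem real_quantizationError_gt (hs : IsRVQSystem μ H G V W j) {t : ℝ}
    (ht0 : 0 < t) (ht1 : t ≤ 1) :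
    μ.real {ω | t < quantizationError H W j ω} ≤ Real.exp (-(2 ^ B * t ^ n)) := by
  have hpi : ∀ i, IsProbabilityMeasure (μ.map (W i)) := fun i =>
    Measure.isProbabilityMeasure_map (hs.aemeasurable_W i)
  set S : Set ((Fin (n + 1) → ℂ) × (Fin (2 ^ B) → CVec (n + 1))) :=
    {p | ∀ i, ‖rowMul p.1 (p.2 i)‖ ^ 2 < (1 - t) * ∑ k, ‖p.1 k‖ ^ 2} with hS
  have hm : MeasurableSet S := by
    rw [hS]
    simp only [Set.ofPred_forall]
    exact MeasurableSet.iInter fun i => measurableSet_lt (by fun_prop) (by fun_prop)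
  have h1 : {ω | t < quantizationError H W j ω} ≤ᵐ[μ]
      (fun ω => (H ω, fun i => W i ω)) ⁻¹' S := by
    filter_upwards [hs.ae_selected_gain_eq, hs.ae_selected_gain_ge, hs.ae_gain_pos] with ω h2 h3 h4
    intro h5 i
    replace h5 : t < quantizationError H W j ω := h5
    refine (h3 i).trans_lt ?_
    rw [h2, mul_comm]
    gcongr
  have h2 := Measure.map_apply_of_aemeasurable
    (hs.law_H.aemeasurable.prodMk hs.aemeasurable_codebook) hm
  rw [hs.map_H_codebook, Measure.prod_apply hm] at h2
  have ht : 0 ≤ 1 - t ^ n := sub_nonneg.2 (pow_le_one₀ ht0.le ht1)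
  have h3 : (∫⁻ h, (Measure.pi fun i => μ.map (W i)) (Prod.mk h ⁻¹' S) ∂stdGaussianVec (n + 1))
      = ENNReal.ofReal ((1 - t ^ n) ^ 2 ^ B) := by
    refine (lintegral_congr_ae (g := fun _ => ENNReal.ofReal ((1 - t ^ n) ^ 2 ^ B)) ?_).trans
      (by simp)
    filter_upwards [ae_stdGaussianVec_sum_pos n] with h hh
    have hpre : Prod.mk h ⁻¹' S = Set.univ.pi fun _ : Fin (2 ^ B) =>
        {w : CVec (n + 1) | (1 - t) * ∑ k, ‖h k‖ ^ 2 ≤ ‖rowMul h w‖ ^ 2}ᶜ := by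
      ext w
      simp [hS]
    have hmh : MeasurableSet {w : CVec (n + 1) | (1 - t) * ∑ k, ‖h k‖ ^ 2 ≤ ‖rowMul h w‖ ^ 2} :=
      measurableSet_le (by fun_prop) (by fun_prop)
    rw [hpre, Measure.pi_pi]
    have : ∀ i, μ.map (W i) {w : CVec (n + 1) | (1 - t) * ∑ k, ‖h k‖ ^ 2 ≤ ‖rowMul h w‖ ^ 2}ᶜ
        = ENNReal.ofReal (1 - t ^ n) := fun i => by
      rw [← ofReal_measureReal, probReal_compl_eq_one_sub hmh,
        (hs.law_W i).real_rowMul_ge hh ht0 ht1]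
    simp only [this, Finset.prod_const, Finset.card_univ, Fintype.card_fin]
    rw [ENNReal.ofReal_pow ht]
  rw [h3] at h2
  calc μ.real {ω | t < quantizationError H W j ω}
      ≤ μ.real ((fun ω => (H ω, fun i => W i ω)) ⁻¹' S) :=
        ENNReal.toReal_mono (measure_ne_top _ _) (measure_mono_ae h1)
    _ = (1 - t ^ n) ^ 2 ^ B := by
        rw [measureReal_def, ← h2, ENNReal.toReal_ofReal (by positivity)]
    _ ≤ Real.exp (-(t ^ n)) ^ 2 ^ B := by
        gcongr
        linarith [Real.add_one_le_exp (-(t ^ n))]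
    _ = Real.exp (-(2 ^ B * t ^ n)) := by
        rw [← Real.exp_nat_mul]
        push_cast
        ring_nf

/-- The deviation is at most `ε` off the two tail events and at most 1 on them. -/
theorem integral_abs_quantizationError_sub_le (hs : IsRVQSystem μ H G V W j) (hn : 1 ≤ n)
    {D ε : ℝ} (hD0 : 0 ≤ D) (hD1 : D ≤ 1) (hε : 0 < ε) :
    ∫ ω, |quantizationError H W j ω - D| ∂μ ≤ ε +
      μ.real {ω | quantizationError H W j ω ≤ D - ε} +
      μ.real {ω | D + ε < quantizationError H W j ω} := by
  set d := quantizationError H W j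
  have hd := hs.aemeasurable_quantizationError hn
  have h1 : NullMeasurableSet {ω | d ω ≤ D - ε} μ := nullMeasurableSet_le hd (by fun_prop)
  have h2 : NullMeasurableSet {ω | D + ε < d ω} μ := nullMeasurableSet_lt (by fun_prop) hd
  have i1 : Integrable ({ω | d ω ≤ D - ε}.indicator (1 : Ω → ℝ)) μ :=
    (integrable_const (1 : ℝ)).indicator₀ h1
  have i2 : Integrable ({ω | D + ε < d ω}.indicator (1 : Ω → ℝ)) μ :=
    (integrable_const (1 : ℝ)).indicator₀ h2
  calc ∫ ω, |d ω - D| ∂μ ≤ ∫ ω, (ε + {ω | d ω ≤ D - ε}.indicator (1 : Ω → ℝ) ω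
        + {ω | D + ε < d ω}.indicator (1 : Ω → ℝ) ω) ∂μ := by
        refine integral_mono_ae ((hs.integrable_quantizationError hn).sub (integrable_const _)).abs
          (((integrable_const ε).add i1).add i2) ?_
        filter_upwards [hs.ae_quantizationError_mem_Icc] with ω hω
        have hle : |d ω - D| ≤ 1 := abs_le.2 ⟨by linarith [hω.1], by linarith [hω.2]⟩
        by_cases c1 : d ω ≤ D - ε
        · by_cases c2 : D + ε < d ω
          · linarith
          · simp [Set.indicator, c1, c2]; linarith
        · by_cases c2 : D + ε < d ω
          · simp [Set.indicator, c1, c2]; linarith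
          · simp only [Set.indicator, Set.mem_ofPred_eq, c1, c2, if_false, add_zero]
            exact abs_le.2 ⟨by linarith, by linarith⟩
    _ = _ := by
        rw [integral_add (f := fun ω => ε + {ω | d ω ≤ D - ε}.indicator (1 : Ω → ℝ) ω)
          ((integrable_const ε).add i1) i2, integral_add (integrable_const ε) i1,
          integral_indicator₀ h1, integral_indicator₀ h2]
        simp

end IsRVQSystem

/-! ### The ergodic rate loss of a fixed system -/

namespace IsRVQSystem

variable {Ω : Type*} [MeasurableSpace Ω] {μ : Measure Ω} {n B : ℕ}
  {H G : Ω → Fin (n + 1) → ℂ} {V : Ω → Precoder (n + 1)}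
  {W : Fin (2 ^ B) → Ω → CVec (n + 1)} {j : Ω → Fin (2 ^ B)} {su sv sE : ℝ}

theorem perfectRate_ae_eq (hs : IsRVQSystem μ H G V W j) (hsu : 0 ≤ su) (hsv : 0 ≤ sv)
    (hsE : 0 < sE) : perfectRate su sv sE H G V =ᵐ[μ] fun ω =>
      beamRate su sv 1 (∑ i, ‖H ω i‖ ^ 2) (‖rowMul (H ω) (matchedBeam (H ω))‖ ^ 2)
      - beamRate su sv sE (∑ i, ‖G ω i‖ ^ 2) (‖rowMul (G ω) (matchedBeam (H ω))‖ ^ 2) := by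
  filter_upwards [hs.null_space, hs.ae_gain_pos] with ω h1 h2
  rw [perfectRate, secrecyRate_eq hsu hsv hsE, norm_rowMul_matchedBeam h2 h1,
    norm_rowMul_matchedBeam h2 h1]

theorem quantizedRate_ae_eq (hs : IsRVQSystem μ H G V W j) (hsu : 0 ≤ su) (hsv : 0 ≤ sv)
    (hsE : 0 < sE) : quantizedRate su sv sE H G W j =ᵐ[μ] fun ω =>
      beamRate su sv 1 (∑ i, ‖H ω i‖ ^ 2) (‖rowMul (H ω) (W (j ω) ω)‖ ^ 2)
      - beamRate su sv sE (∑ i, ‖G ω i‖ ^ 2) (‖rowMul (G ω) (W (j ω) ω)‖ ^ 2) := by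
  filter_upwards [hs.ae_norm_selected] with ω h1
  rw [quantizedRate, secrecyRate_eq hsu hsv hsE, gramSchmidtPrecoder_zero h1]

theorem ae_norm_matchedBeam (hs : IsRVQSystem μ H G V W j) :
    ∀ᵐ ω ∂μ, ‖matchedBeam (H ω)‖ = 1 := hs.ae_gain_pos.mono fun _ h => norm_matchedBeam h

theorem aemeasurable_matchedBeam (hs : IsRVQSystem μ H G V W j) :
    AEMeasurable (fun ω => matchedBeam (H ω)) μ :=
  measurable_matchedBeam.comp_aemeasurable hs.law_H.aemeasurable

theorem integrable_perfectRate (hs : IsRVQSystem μ H G V W j) (hsu : 0 ≤ su) (hsv : 0 ≤ sv)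
    (hsE : 0 < sE) : Integrable (perfectRate su sv sE H G V) μ :=
  (integrable_congr (hs.perfectRate_ae_eq hsu hsv hsE)).2
    ((integrable_beamRate hsu hsv one_pos hs.law_H hs.aemeasurable_matchedBeam
      hs.ae_norm_matchedBeam).sub (integrable_beamRate hsu hsv hsE hs.law_G
        hs.aemeasurable_matchedBeam hs.ae_norm_matchedBeam))

variable [IsProbabilityMeasure μ]

theorem integrable_quantizedRate (hs : IsRVQSystem μ H G V W j) (hn : 1 ≤ n) (hsu : 0 ≤ su)
    (hsv : 0 ≤ sv) (hsE : 0 < sE) : Integrable (quantizedRate su sv sE H G W j) μ :=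
  (integrable_congr (hs.quantizedRate_ae_eq hsu hsv hsE)).2
    ((integrable_beamRate hsu hsv one_pos hs.law_H (hs.aemeasurable_selected hn)
      hs.ae_norm_selected).sub (integrable_beamRate hsu hsv hsE hs.law_G
        (hs.aemeasurable_selected hn) hs.ae_norm_selected))

/-- Here `x` and `D` stand for the limits of `su T` and of the error. The gain deviation enters once
from the perfect rate and `2 β + 1` times from the quantized one. Eve's two expected rates both lie
in `[0, su / sE]`, so their difference costs one `su / sE`. -/
theorem abs_ergodicSecrecyRateLoss_sub_le {β x D : ℝ} (hs : IsRVQSystem μ H G V W j) (hn : 1 ≤ n)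
    (hsu : 0 ≤ su) (hβ : 0 ≤ β) (hsE : 0 < sE) (hx : 0 ≤ x) (hD0 : 0 ≤ D) (hD1 : D ≤ 1) :
    |ergodicSecrecyRateLoss μ su (β * su) sE H G V W j - (Real.log (1 + x)
      - (Real.log (1 + x * (β * D + (1 - D))) - Real.log (1 + x * (β * D))))|
      ≤ (2 * β + 2) * ∫ ω, |su * ∑ i, ‖H ω i‖ ^ 2 - x| ∂μ
        + x * (2 * β + 1) * ∫ ω, |quantizationError H W j ω - D| ∂μ + su / sE := by
  have hsv : 0 ≤ β * su := by positivity
  set b₁ : Ω → ℝ := fun ω => beamRate su (β * su) 1 (∑ i, ‖H ω i‖ ^ 2)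
    (‖rowMul (H ω) (matchedBeam (H ω))‖ ^ 2) with hb₁
  set e₁ : Ω → ℝ := fun ω => beamRate su (β * su) sE (∑ i, ‖G ω i‖ ^ 2)
    (‖rowMul (G ω) (matchedBeam (H ω))‖ ^ 2) with he₁
  set b₂ : Ω → ℝ := fun ω => beamRate su (β * su) 1 (∑ i, ‖H ω i‖ ^ 2)
    (‖rowMul (H ω) (W (j ω) ω)‖ ^ 2) with hb₂
  set e₂ : Ω → ℝ := fun ω => beamRate su (β * su) sE (∑ i, ‖G ω i‖ ^ 2)
    (‖rowMul (G ω) (W (j ω) ω)‖ ^ 2) with he₂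
  have ib₁ : Integrable b₁ μ := integrable_beamRate hsu hsv one_pos hs.law_H
    hs.aemeasurable_matchedBeam hs.ae_norm_matchedBeam
  have ie₁ : Integrable e₁ μ := integrable_beamRate hsu hsv hsE hs.law_G
    hs.aemeasurable_matchedBeam hs.ae_norm_matchedBeam
  have ib₂ : Integrable b₂ μ := integrable_beamRate hsu hsv one_pos hs.law_H
    (hs.aemeasurable_selected hn) hs.ae_norm_selected
  have ie₂ : Integrable e₂ μ := integrable_beamRate hsu hsv hsE hs.law_G
    (hs.aemeasurable_selected hn) hs.ae_norm_selected
  have me₁ : ∫ ω, e₁ ω ∂μ ∈ Set.Icc 0 (su / sE) := integral_beamRate_mem_Icc hsu hsv hsE hs.law_G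
    hs.aemeasurable_matchedBeam hs.ae_norm_matchedBeam
    (hs.indepFun_H_codebook_G.comp (measurable_matchedBeam.comp measurable_fst) measurable_id)
  have me₂ : ∫ ω, e₂ ω ∂μ ∈ Set.Icc 0 (su / sE) := integral_beamRate_mem_Icc hsu hsv hsE hs.law_G
    (hs.aemeasurable_selected hn) hs.ae_norm_selected (hs.indepFun_selected_G hn)
  have hloss : ergodicSecrecyRateLoss μ su (β * su) sE H G V W j
      = (∫ ω, b₁ ω ∂μ - ∫ ω, e₁ ω ∂μ) - (∫ ω, b₂ ω ∂μ - ∫ ω, e₂ ω ∂μ) := by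
    rw [ergodicSecrecyRateLoss, integral_congr_ae (hs.perfectRate_ae_eq hsu hsv hsE),
      integral_congr_ae (hs.quantizedRate_ae_eq hsu hsv hsE), integral_sub ib₁ ie₁,
      integral_sub ib₂ ie₂]
  have iX : Integrable (fun ω => |su * ∑ i, ‖H ω i‖ ^ 2 - x|) μ :=
    (((integrable_sum_norm_sq hs.law_H).const_mul su).sub (integrable_const x)).abs
  have iD : Integrable (fun ω => |quantizationError H W j ω - D|) μ :=
    ((hs.integrable_quantizationError hn).sub (integrable_const D)).abs
  have habs : ∀ {b : Ω → ℝ} (_ : Integrable b μ) (L : ℝ),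
      |∫ ω, b ω ∂μ - L| ≤ ∫ ω, |b ω - L| ∂μ := fun {b} hb L => by
    have : ∫ ω, (b ω - L) ∂μ = ∫ ω, b ω ∂μ - L := by
      rw [integral_sub hb (integrable_const L)]; simp
    rw [← this]
    exact abs_integral_le_integral_abs
  set L₁ := Real.log (1 + x) with hL₁
  set L₂ := Real.log (1 + x * (β * D + (1 - D))) - Real.log (1 + x * (β * D)) with hL₂
  have h1 : |∫ ω, b₁ ω ∂μ - L₁| ≤ ∫ ω, |su * ∑ i, ‖H ω i‖ ^ 2 - x| ∂μ := by
    refine (habs ib₁ L₁).trans (integral_mono_ae (ib₁.sub (integrable_const _)).abs iX ?_)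
    filter_upwards [hs.null_space, hs.ae_gain_pos] with ω h3 h4
    have h5 : b₁ ω = Real.log (1 + su * ∑ i, ‖H ω i‖ ^ 2) := by
      simp only [hb₁]
      rw [norm_rowMul_matchedBeam h4 h3, norm_rowMul_zero_sq_of_null h3, beamRate, sub_self,
        mul_zero, zero_add, div_one, mul_comm]
    rw [h5]
    exact abs_log_one_add_sub_le (by positivity) hx
  have h2 : |∫ ω, b₂ ω ∂μ - L₂| ≤ (2 * β + 1) * ∫ ω, |su * ∑ i, ‖H ω i‖ ^ 2 - x| ∂μ
      + x * (2 * β + 1) * ∫ ω, |quantizationError H W j ω - D| ∂μ := by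
    rw [← integral_const_mul, ← integral_const_mul,
      ← integral_add (iX.const_mul _) (iD.const_mul _)]
    refine (habs ib₂ L₂).trans (integral_mono_ae (ib₂.sub (integrable_const _)).abs
      ((iX.const_mul _).add (iD.const_mul _)) ?_)
    filter_upwards [hs.ae_selected_gain_eq, hs.ae_quantizationError_mem_Icc] with ω h3 h4
    simp only [hb₂]
    rw [h3]
    exact abs_beamRate_sub_le hsu hβ (by positivity) h4.1 h4.2 hD0 hD1 hx
  have h3 : |∫ ω, e₂ ω ∂μ - ∫ ω, e₁ ω ∂μ| ≤ su / sE :=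
    abs_le.2 ⟨by linarith [me₁.2, me₂.1], by linarith [me₂.2, me₁.1]⟩
  rw [hloss]
  calc |(∫ ω, b₁ ω ∂μ - ∫ ω, e₁ ω ∂μ) - (∫ ω, b₂ ω ∂μ - ∫ ω, e₂ ω ∂μ) - (L₁ - L₂)|
      = |((∫ ω, b₁ ω ∂μ - L₁) - (∫ ω, b₂ ω ∂μ - L₂)) + (∫ ω, e₂ ω ∂μ - ∫ ω, e₁ ω ∂μ)| := by
        congr 1; ring
    _ ≤ |∫ ω, b₁ ω ∂μ - L₁| + |∫ ω, b₂ ω ∂μ - L₂| + |∫ ω, e₂ ω ∂μ - ∫ ω, e₁ ω ∂μ| :=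
        (abs_add_le _ _).trans (by gcongr; exact abs_sub _ _)
    _ ≤ _ := by linarith

end IsRVQSystem

/-! ### Asymptotics -/

section Asymptotics

variable {n B : ℕ → ℕ} {Bbar : ℝ}

/-- The exponent is normalized by the antenna number `n + 1`, as in the limit of `B / N_A`; the
factor `1 - 1 / (n + 1)` restores the power `n`. -/
theorem two_pow_mul_pow_eq_exp (n B : ℕ) {t : ℝ} (ht : 0 < t) :
    (2 : ℝ) ^ B * t ^ n = Real.exp (((n : ℝ) + 1) *
      ((B : ℝ) / ((n : ℝ) + 1) * Real.log 2 + (1 - 1 / ((n : ℝ) + 1)) * Real.log t)) := by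
  have h1 : ((n : ℝ) + 1) *
      ((B : ℝ) / ((n : ℝ) + 1) * Real.log 2 + (1 - 1 / ((n : ℝ) + 1)) * Real.log t)
      = B * Real.log 2 + n * Real.log t := by
    field_simp
    ring
  rw [h1, Real.exp_add, Real.exp_nat_mul, Real.exp_nat_mul, Real.exp_log two_pos, Real.exp_log ht]

theorem tendsto_cast_add_one (hn : Tendsto n atTop atTop) :
    Tendsto (fun k => (n k : ℝ) + 1) atTop atTop :=
  tendsto_atTop_add_const_right _ _ (tendsto_natCast_atTop_atTop.comp hn)

theorem tendsto_exponent_rate (hn : Tendsto n atTop atTop)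
    (hBn : Tendsto (fun k => (B k : ℝ) / ((n k : ℝ) + 1)) atTop (𝓝 Bbar)) (t : ℝ) :
    Tendsto (fun k => (B k : ℝ) / ((n k : ℝ) + 1) * Real.log 2
      + (1 - 1 / ((n k : ℝ) + 1)) * Real.log t) atTop (𝓝 (Bbar * Real.log 2 + Real.log t)) := by
  have h1 : Tendsto (fun k => 1 / ((n k : ℝ) + 1)) atTop (𝓝 0) :=
    tendsto_const_nhds.div_atTop (tendsto_cast_add_one hn)
  have := (hBn.mul_const (Real.log 2)).add
    ((tendsto_const_nhds (x := (1 : ℝ)).sub h1).mul_const (Real.log t))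
  simpa using this

theorem log_two_rpow_neg (b : ℝ) : Real.log ((2 : ℝ) ^ (-b)) = -(b * Real.log 2) := by
  rw [Real.log_rpow two_pos, neg_mul]

theorem tendsto_two_pow_mul_pow_zero (hn : Tendsto n atTop atTop)
    (hBn : Tendsto (fun k => (B k : ℝ) / ((n k : ℝ) + 1)) atTop (𝓝 Bbar)) {t : ℝ} (ht : 0 < t)
    (htD : t < (2 : ℝ) ^ (-Bbar)) :
    Tendsto (fun k => (2 : ℝ) ^ B k * t ^ n k) atTop (𝓝 0) := by
  have h1 : Bbar * Real.log 2 + Real.log t < 0 := by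
    have := Real.log_lt_log ht htD
    rw [log_two_rpow_neg] at this
    linarith
  simp_rw [two_pow_mul_pow_eq_exp _ _ ht]
  exact Real.tendsto_exp_atBot.comp
    ((tendsto_cast_add_one hn).atTop_mul_neg h1 (tendsto_exponent_rate hn hBn t))

theorem tendsto_two_pow_mul_pow_atTop (hn : Tendsto n atTop atTop)
    (hBn : Tendsto (fun k => (B k : ℝ) / ((n k : ℝ) + 1)) atTop (𝓝 Bbar)) {t : ℝ} (ht : 0 < t)
    (htD : (2 : ℝ) ^ (-Bbar) < t) :
    Tendsto (fun k => (2 : ℝ) ^ B k * t ^ n k) atTop atTop := by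
  have h1 : 0 < Bbar * Real.log 2 + Real.log t := by
    have := Real.log_lt_log (Real.rpow_pos_of_pos two_pos _) htD
    rw [log_two_rpow_neg] at this
    linarith
  simp_rw [two_pow_mul_pow_eq_exp _ _ ht]
  exact Real.tendsto_exp_atTop.comp
    ((tendsto_cast_add_one hn).atTop_mul_pos h1 (tendsto_exponent_rate hn hBn t))

variable {Ω : ℕ → Type*} [∀ k, MeasurableSpace (Ω k)]
  {μ : ∀ k, Measure (Ω k)} [∀ k, IsProbabilityMeasure (μ k)]
  {H G : ∀ k, Ω k → Fin (n k + 1) → ℂ} {V : ∀ k, Ω k → Precoder (n k + 1)}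
  {W : ∀ k, Fin (2 ^ B k) → Ω k → CVec (n k + 1)} {j : ∀ k, Ω k → Fin (2 ^ B k)}

/-- The quantization error converges to `2 ^ (-Bbar)` in mean. -/
theorem tendsto_integral_abs_quantizationError_sub
    (hs : ∀ k, IsRVQSystem (μ k) (H k) (G k) (V k) (W k) (j k)) (hn_pos : ∀ k, 1 ≤ n k)
    (hn : Tendsto n atTop atTop)
    (hBn : Tendsto (fun k => (B k : ℝ) / ((n k : ℝ) + 1)) atTop (𝓝 Bbar)) (hB0 : 0 ≤ Bbar) :
    Tendsto (fun k => ∫ ω, |quantizationError (H k) (W k) (j k) ω - (2 : ℝ) ^ (-Bbar)| ∂μ k)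
      atTop (𝓝 0) := by
  set D : ℝ := (2 : ℝ) ^ (-Bbar) with hD
  have hD0 : 0 < D := Real.rpow_pos_of_pos two_pos _
  have hD1 : D ≤ 1 := Real.rpow_le_one_of_one_le_of_nonpos one_le_two (neg_nonpos.2 hB0)
  have hle : ∀ ε : ℝ, 0 < ε → ε < D → Tendsto (fun k =>
      (μ k).real {ω | quantizationError (H k) (W k) (j k) ω ≤ D - ε}) atTop (𝓝 0) := by
    intro ε hε hεD
    exact squeeze_zero (fun k => measureReal_nonneg)
      (fun k => (hs k).real_quantizationError_le (by linarith) (by linarith))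
      (tendsto_two_pow_mul_pow_zero hn hBn (by linarith) (by linarith))
  have hgt : ∀ ε : ℝ, 0 < ε → Tendsto (fun k =>
      (μ k).real {ω | D + ε < quantizationError (H k) (W k) (j k) ω}) atTop (𝓝 0) := by
    intro ε hε
    -- The tail bound needs a level at most 1; beyond 1 the event is null.
    rcases le_or_gt (D + ε) 1 with h1 | h1
    · exact squeeze_zero (fun k => measureReal_nonneg)
        (fun k => (hs k).real_quantizationError_gt (by linarith) h1)
        (Real.tendsto_exp_neg_atTop_nhds_zero.comp
          (tendsto_two_pow_mul_pow_atTop hn hBn (by linarith) (by linarith)))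
    · have : ∀ k, (μ k).real {ω | D + ε < quantizationError (H k) (W k) (j k) ω} = 0 := by
        intro k
        rw [measureReal_eq_zero_iff]
        refine measure_mono_null ?_ (ae_iff.1 (hs k).ae_quantizationError_mem_Icc)
        intro ω h2 h3
        exact absurd (h1.trans h2) h3.2.not_gt
      simp [this]
  rw [Metric.tendsto_atTop']
  intro ε hε
  -- One third for each of the three terms of the bound; `D / 2` keeps the level `D - δ` positive.
  set δ := min (ε / 3) (D / 2) with hδ
  have hδ0 : 0 < δ := lt_min (by positivity) (by positivity)
  have hδD : δ < D := (min_le_right _ _).trans_lt (by linarith)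
  have hδε : δ ≤ ε / 3 := min_le_left _ _
  have h1 := (hle δ hδ0 hδD).eventually_lt_const (show (0 : ℝ) < ε / 3 by positivity)
  have h2 := (hgt δ hδ0).eventually_lt_const (show (0 : ℝ) < ε / 3 by positivity)
  obtain ⟨K, hK⟩ := eventually_atTop.1 (h1.and h2)
  refine ⟨K, fun k hk => ?_⟩
  rw [Real.dist_eq, sub_zero, abs_of_nonneg (integral_nonneg fun _ => abs_nonneg _)]
  have := (hs k).integral_abs_quantizationError_sub_le (hn_pos k) hD0.le hD1 hδ0
  linarith [(hK k hk.le).1, (hK k hk.le).2]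

end Asymptotics

/-! ### Asymptotics of the power allocation -/

section Power

variable {P β : ℝ} {n : ℕ → ℕ}

theorem signalPower_eq (hβ : 0 < β) {su sv : ℝ} {m : ℕ} (hratio : sv = β * su)
    (hpower : P = su + sv * m) : su = P / (1 + β * m) := by
  rw [eq_div_iff (by positivity), hpower, hratio]
  ring

/-- The denominator `1 + β m` is at least `min 1 β * (m + 1)`, which turns the power into a multiple
of the inverse antenna number. -/
theorem signalPower_le (hP : 0 < P) (hβ : 0 < β) (m : ℕ) :
    P / (1 + β * m) ≤ P / min 1 β / ((m : ℝ) + 1) := by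
  have h0 : 0 < min 1 β := lt_min one_pos hβ
  rw [div_div]
  gcongr
  nlinarith [min_le_left 1 β, min_le_right 1 β, (Nat.cast_nonneg m : (0 : ℝ) ≤ m)]

theorem tendsto_signalPower (hP : 0 < P) (hβ : 0 < β) (hn : Tendsto n atTop atTop) :
    Tendsto (fun k => P / (1 + β * n k)) atTop (𝓝 0) :=
  squeeze_zero (fun k => by positivity) (fun k => signalPower_le hP hβ (n k))
    (tendsto_const_nhds.div_atTop (tendsto_cast_add_one hn))

theorem tendsto_signalPower_mul_sqrt (hP : 0 < P) (hβ : 0 < β) (hn : Tendsto n atTop atTop) :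
    Tendsto (fun k => P / (1 + β * n k) * √((n k : ℝ) + 1)) atTop (𝓝 0) := by
  refine squeeze_zero (fun k => by positivity)
    (g := fun k => P / min 1 β / √((n k : ℝ) + 1)) (fun k => ?_)
    (tendsto_const_nhds.div_atTop (Real.tendsto_sqrt_atTop.comp (tendsto_cast_add_one hn)))
  have h := Real.mul_self_sqrt (show (0 : ℝ) ≤ (n k : ℝ) + 1 by positivity)
  have h1 : 0 < √((n k : ℝ) + 1) := by positivity
  calc P / (1 + β * n k) * √((n k : ℝ) + 1)
      ≤ P / min 1 β / ((n k : ℝ) + 1) * √((n k : ℝ) + 1) :=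
        mul_le_mul_of_nonneg_right (signalPower_le hP hβ (n k)) h1.le
    _ = P / min 1 β / √((n k : ℝ) + 1) := by
        rw [div_mul_eq_mul_div, div_eq_div_iff (by positivity) h1.ne', mul_assoc, h]

theorem tendsto_signalPower_mul_antennas (hP : 0 < P) (hβ : 0 < β) (hn : Tendsto n atTop atTop) :
    Tendsto (fun k => |P / (1 + β * n k) * ((n k : ℝ) + 1) - P / β|) atTop (𝓝 0) := by
  have h1 : ∀ k, P / (1 + β * n k) * ((n k : ℝ) + 1) - P / β
      = P / (1 + β * n k) * ((β - 1) / β) := fun k => by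
    field_simp
    ring
  simp_rw [h1]
  simpa using ((tendsto_signalPower hP hβ hn).mul_const ((β - 1) / β)).abs

end Power

end

theorem mainTheorem4 (P β γ Bbar : ℝ) (hP : 0 < P) (hβ : 0 < β) (hγ : 0 < γ)
    -- `n k + 1` transmit antennas and `B k` feedback bits
    (n B : ℕ → ℕ) (hn_pos : ∀ k, 1 ≤ n k)
    (hn : Tendsto n atTop atTop) (hB : Tendsto B atTop atTop)
    (hBn : Tendsto (fun k => (B k : ℝ) / ((n k : ℝ) + 1)) atTop (𝓝 Bbar))
    -- signal and artificial noise variances, with fixed ratio and fixed total power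
    (su sv : ℕ → ℝ) (hratio : ∀ k, sv k = β * su k)
    (hpower : ∀ k, P = su k + sv k * (n k : ℝ))
    {Ω : ℕ → Type*} [∀ k, MeasurableSpace (Ω k)]
    (μ : ∀ k, Measure (Ω k)) [∀ k, IsProbabilityMeasure (μ k)]
    (H G : ∀ k, Ω k → Fin (n k + 1) → ℂ) (V : ∀ k, Ω k → Precoder (n k + 1))
    (W : ∀ k, Fin (2 ^ B k) → Ω k → CVec (n k + 1)) (j : ∀ k, Ω k → Fin (2 ^ B k))
    (hsys : ∀ k, IsRVQSystem (μ k) (H k) (G k) (V k) (W k) (j k)) :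
    -- all mutual informations are finite and both rates are integrable
    (∀ k (h : Fin (n k + 1) → ℂ) (U : Precoder (n k + 1)),
      mutualInfo (channelLaw (su k) (sv k) 1 h U) ≠ ∞ ∧
      mutualInfo (channelLaw (su k) (sv k) γ h U) ≠ ∞) ∧
    (∀ k, Integrable (perfectRate (su k) (sv k) γ (H k) (G k) (V k)) (μ k) ∧
      Integrable (quantizedRate (su k) (sv k) γ (H k) (G k) (W k) (j k)) (μ k)) ∧
    Tendsto
      (fun k => ergodicSecrecyRateLoss (μ k) (su k) (sv k) γ (H k) (G k) (V k) (W k) (j k))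
      atTop
      (𝓝 (Real.log (1 + P / β) + Real.log (1 + (2 : ℝ) ^ (-Bbar) * P)
        - Real.log (1 + P + (1 - β) / β * (1 - (2 : ℝ) ^ (-Bbar)) * P))) := by
  have hsu_eq : ∀ k, su k = P / (1 + β * n k) := fun k =>
    signalPower_eq hβ (hratio k) (hpower k)
  have hsu : ∀ k, 0 ≤ su k := fun k => by rw [hsu_eq]; positivity
  have hsv : ∀ k, 0 ≤ sv k := fun k => by rw [hratio]; exact mul_nonneg hβ.le (hsu k)
  refine ⟨fun k h U => ⟨(mutualInfo_channelLaw (hsu k) (hsv k) one_pos h U).1,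
    (mutualInfo_channelLaw (hsu k) (hsv k) hγ h U).1⟩,
    fun k => ⟨(hsys k).integrable_perfectRate (hsu k) (hsv k) hγ,
      (hsys k).integrable_quantizedRate (hn_pos k) (hsu k) (hsv k) hγ⟩, ?_⟩
  -- A limit of nonnegative ratios is nonnegative, so `2 ^ (-Bbar) ≤ 1` is an admissible limit for
  -- the error.
  have hB0 : 0 ≤ Bbar := ge_of_tendsto' hBn fun k => by positivity
  have hD0 : 0 < (2 : ℝ) ^ (-Bbar) := Real.rpow_pos_of_pos two_pos _
  have hD1 : (2 : ℝ) ^ (-Bbar) ≤ 1 :=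
    Real.rpow_le_one_of_one_le_of_nonpos one_le_two (neg_nonpos.2 hB0)
  have hgain : Tendsto (fun k => ∫ ω, |su k * ∑ i, ‖H k ω i‖ ^ 2 - P / β| ∂μ k) atTop (𝓝 0) := by
    refine squeeze_zero (fun k => integral_nonneg fun _ => abs_nonneg _)
      (fun k => integral_abs_mul_gain_sub_le (Nat.succ_pos _) (hsys k).law_H (hsu k) (P / β)) ?_
    simp_rw [hsu_eq]
    push_cast
    simpa using (tendsto_signalPower_mul_sqrt hP hβ hn).add
      (tendsto_signalPower_mul_antennas hP hβ hn)
  have hquant := tendsto_integral_abs_quantizationError_sub hsys hn_pos hn hBn hB0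
  have heve : Tendsto (fun k => su k / γ) atTop (𝓝 0) := by
    simp_rw [hsu_eq]
    simpa using (tendsto_signalPower hP hβ hn).div_const γ
  -- The claimed limit is the expression of the error bound at `x = P / β` and `D = 2 ^ (-Bbar)`.
  have hlim : Real.log (1 + P / β) + Real.log (1 + (2 : ℝ) ^ (-Bbar) * P)
        - Real.log (1 + P + (1 - β) / β * (1 - (2 : ℝ) ^ (-Bbar)) * P)
      = Real.log (1 + P / β) - (Real.log (1 + P / β * (β * (2 : ℝ) ^ (-Bbar)
        + (1 - (2 : ℝ) ^ (-Bbar)))) - Real.log (1 + P / β * (β * (2 : ℝ) ^ (-Bbar)))) := by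
    have h1 : 1 + P + (1 - β) / β * (1 - (2 : ℝ) ^ (-Bbar)) * P
        = 1 + P / β * (β * (2 : ℝ) ^ (-Bbar) + (1 - (2 : ℝ) ^ (-Bbar))) := by
      field_simp
      ring
    have h2 : 1 + (2 : ℝ) ^ (-Bbar) * P = 1 + P / β * (β * (2 : ℝ) ^ (-Bbar)) := by
      field_simp
    rw [h1, h2]
    ring
  rw [hlim, tendsto_iff_dist_tendsto_zero]
  refine squeeze_zero (fun k => dist_nonneg) (fun k => ?_)
    (g := fun k => (2 * β + 2) * ∫ ω, |su k * ∑ i, ‖H k ω i‖ ^ 2 - P / β| ∂μ k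
      + P / β * (2 * β + 1) *
        ∫ ω, |quantizationError (H k) (W k) (j k) ω - (2 : ℝ) ^ (-Bbar)| ∂μ k + su k / γ) ?_
  · rw [Real.dist_eq, hratio k]
    exact (hsys k).abs_ergodicSecrecyRateLoss_sub_le (hn_pos k) (hsu k) hβ.le hγ (by positivity)
      hD0.le hD1
  · simpa using ((hgain.const_mul (2 * β + 2)).add
      (hquant.const_mul (P / β * (2 * β + 1)))).add heve
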